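/- Let $\pi\colon E\to M$ be a smooth fibre bundle (or, more generally, a surjective submersion) with $\dim M=m$, $\dim E=m+n$, let $\omega$ be a volume form on $M$, let $L\in C^\infty(J^2\pi)$ and let $\mathcal L=L\,\omega$ be the corresponding second-order Lagrangian form. In natural coordinates $(x^i,u^\alpha_I)$ of the jet bundles, i.e. fibred coordinates with $\omega=d^mx=dx^1\wedge\dots\wedge dx^m$, let $D_i$ be the total derivatives, $d^{m-1}x_i=i(\partial/\partial x^i)d^mx$, let $n(ij)=1$ if $i=j$ and $n(ij)=2$ if $i\ne j$, and put $$L^{ij}_\alpha=\frac1{n(ij)}\frac{\partial L}{\partial u^\alpha_{1_i+1_j}},\qquad L^i_\alpha=\frac{\partial L}{\partial u^\alpha_i}-D_jL^{ij}_\alpha,$$ $$\Theta_{\mathcal L}=L^i_\alpha\,du^\alpha\wedge d^{m-1}x_i+L^{ij}_\alpha\,du^\alpha_i\wedge d^{m-1}x_j+\bigl(L-L^i_\alpha u^\alpha_i-L^{ij}_\alpha u^\alpha_{1_i+1_j}\bigr)d^mx$$ (the Poincar\'e--Cartan form on $J^3\pi$), and $$L^0_\alpha=\frac{\partial L}{\partial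 u^\alpha}-D_iL^i_\alpha=\frac{\partial L}{\partial u^\alpha}-D_i\frac{\partial L}{\partial u^\alpha_i}+\sum_{|I|=2}D_I\frac{\partial L}{\partial u^\alpha_I}.$$ An $m$-multivector field $\mathbf X$ on a subset $N$ of $J^3\pi$ is called holonomic if it is non-vanishing, smooth and locally decomposable, if through every point of $N$ there passes an integral section of $\mathbf X$ contained in $N$, and if all its integral sections in $N$ are prolongations $j^3\phi$ of local sections $\phi$ of $\pi$. It is a solution of the Euler--Lagrange equations on $N$ if moreover $i(\mathbf X)\,d\Theta_{\mathcal L}=0$ at all points of $N$. Let $s\in\{1,2\}$ and suppose that $\Theta_{\mathcal L}$ projects onto $J^s\pi$, i.e. is the pull-back of a smooth form on $J^s\pi$. Then in every natural coordinate domain the functions $L^0_\alpha$ are smooth functions on $J^3\pi$ if $s=2$, and on $J^2\pi$ if $s=1$ (so that the $D_iL^0_\alpha$ are functions on $J^3\pi$), and solutions of the Euler--Lagrange equations exist only at points of the subset $\mathcal S\subset J^3\pi$ (a submanifold whenever the constraints are regular) which is defined in these coordinates by * $L^0_\alpha=0$ for all $\alpha$, if $s=2$; * $L^0_\alpha=0$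 and $D_iL^0_\alpha=0$ for all $\alpha,i$, if $s=1$. That is, if there is a solution on a subset $N$ of the coordinate domain (an open set, the image of an integral section, a submanifold, ...), then $N\subset\mathcal S$. More precisely, at a point $p\in J^3\pi$ of the coordinate domain: * for $s=1,2$, there is a holonomic multivector field $\mathbf X$ on a neighbourhood of $p$ with $i(\mathbf X)\,d\Theta_{\mathcal L}=0$ at $p$ if and only if $L^0_\alpha(p)=0$ for all $\alpha$; * for $s=1$, there is such an $\mathbf X$ which in addition satisfies at $p$ the tangency condition (that is, $\mathbf X_p=v_1\wedge\dots\wedge v_m$ with $v_i(L^0_\alpha)=0$ for all $i,\alpha$) if and only if $L^0_\alpha(p)=0$ and $D_iL^0_\alpha(p)=0$ for all $\alpha,i$. -/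

import Mathlib

open scoped Manifold ContDiff

noncomputable section

namespace SecondOrderFieldTheory

/-! ### Coordinates of jets -/

/-- Multi-indices `I` in `m` variables of length `|I| ≤ k`. -/
abbrev MultiIndex (m k : ℕ) : Type := {I : Fin m → ℕ // ∑ i, I i ≤ k}

instance multiIndexFinite (m k : ℕ) : Finite (MultiIndex m k) := by
  refine Set.Finite.subset (Set.finite_Icc (0 : Fin m → ℕ) (fun _ => k)) ?_
  intro I hI
  refine ⟨fun i => Nat.zero_le _, fun i => ?_⟩
  exact le_trans (Finset.single_le_sum (f := I) (fun _ _ => Nat.zero_le _) (Finset.mem_univ i)) hI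

instance multiIndexFintype (m k : ℕ) : Fintype (MultiIndex m k) := Fintype.ofFinite _

/-- The multi-index `1_i`. -/
def one {m : ℕ} (i : Fin m) : Fin m → ℕ := Pi.single i 1

/-- The space of coordinates `(x^i, u^α_I)`, `|I| ≤ k`, of `k`-jets of maps from `ℝ^m` to `ℝ^n`.
The coordinate `u^α` is `u^α_0`. -/
abbrev JetCoord (m n k : ℕ) : Type := (Fin m → ℝ) × (MultiIndex m k → Fin n → ℝ)

/-- The coordinate function `u^α_I` (it is only used for `|I| ≤ k`). -/
def uCoord {m n k : ℕ} (I : Fin m → ℕ) (α : Fin n) : JetCoord m n k →L[ℝ] ℝ :=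
  if h : ∑ i, I i ≤ k then
    (ContinuousLinearMap.proj α).comp
      ((ContinuousLinearMap.proj (⟨I, h⟩ : MultiIndex m k)).comp
        (ContinuousLinearMap.snd ℝ (Fin m → ℝ) (MultiIndex m k → Fin n → ℝ)))
  else 0

/-- The coordinate function `x^i`; being linear, it is also the `1`-form `dx^i`. -/
def xCoord {m n k : ℕ} (i : Fin m) : JetCoord m n k →L[ℝ] ℝ :=
  (ContinuousLinearMap.proj i).comp
    (ContinuousLinearMap.fst ℝ (Fin m → ℝ) (MultiIndex m k → Fin n → ℝ))

/-- The projection `π^k_l` from `k`-jets to `l`-jets in coordinates, for `l ≤ k`: it forgets the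
coordinates `u^α_I` with `|I| > l`. -/
def jetProj (m n k l : ℕ) : JetCoord m n k →L[ℝ] JetCoord m n l :=
  (ContinuousLinearMap.fst ℝ (Fin m → ℝ) (MultiIndex m k → Fin n → ℝ)).prod
    (ContinuousLinearMap.pi fun I : MultiIndex m l =>
      ContinuousLinearMap.pi fun α : Fin n => uCoord I.1 α)

/-- The coordinate vector `∂/∂u^α_I`. -/
def uVec {m n k : ℕ} (I : Fin m → ℕ) (α : Fin n) : JetCoord m n k :=
  (0, fun J β => if J.1 = I ∧ β = α then 1 else 0)

/-- The partial derivative `∂f/∂u^α_I`. -/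
def partialU {m n k : ℕ} (I : Fin m → ℕ) (α : Fin n) (f : JetCoord m n k → ℝ) :
    JetCoord m n k → ℝ :=
  fun y => fderiv ℝ f y (uVec I α)

/-- The coordinate total derivative `D_i = ∂/∂x^i + ∑ u^α_{I+1_i} ∂/∂u^α_I` (sum over `|I| ≤ k`)
as a vector field along the projection from `(k+1)`-jets to `k`-jets. -/
def totalVec {m n k : ℕ} (i : Fin m) (y : JetCoord m n (k + 1)) : JetCoord m n k :=
  (Pi.single i 1, fun I α => uCoord (I.1 + one i) α y)

/-- `D_i f`, a function of `(k+1)`-jets when `f` is a function of `k`-jets. -/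
def totalDeriv {m n k : ℕ} (i : Fin m) (f : JetCoord m n k → ℝ) : JetCoord m n (k + 1) → ℝ :=
  fun y => fderiv ℝ f (jetProj m n (k + 1) k y) (totalVec i y)

/-- The partial derivative `∂f/∂x^i` on `ℝ^m`. -/
def pderiv {m : ℕ} (i : Fin m) (f : (Fin m → ℝ) → ℝ) : (Fin m → ℝ) → ℝ :=
  fun x => fderiv ℝ f x (Pi.single i 1)

/-- The partial derivative `∂_I f` for a multi-index `I`. -/
def multiDeriv {m : ℕ} (I : Fin m → ℕ) (f : (Fin m → ℝ) → ℝ) : (Fin m → ℝ) → ℝ :=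
  (List.finRange m).foldr (fun i g => (pderiv i)^[I i] g) f

/-- The `k`-jet prolongation `x ↦ j^k_x φ` in coordinates. -/
def prolong {m n : ℕ} (k : ℕ) (φ : (Fin m → ℝ) → Fin n → ℝ) (x : Fin m → ℝ) : JetCoord m n k :=
  (x, fun I α => multiDeriv I.1 (fun x' => φ x' α) x)

/-! ### The functions and the form attached to a Lagrangian function, in natural coordinates -/

/-- The combinatorial factor `n(ij)`. -/
def nfac {m : ℕ} (i j : Fin m) : ℝ := if i = j then 1 else 2

/-- `L^{ij}_α = (1/n(ij)) ∂L/∂u^α_{1_i+1_j}`, a function of `2`-jets. -/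
def legendre2 {m n : ℕ} (L : JetCoord m n 2 → ℝ) (α : Fin n) (i j : Fin m) :
    JetCoord m n 2 → ℝ :=
  fun y => (1 / nfac i j) * partialU (one i + one j) α L y

/-- `L^i_α = ∂L/∂u^α_i - ∑_j D_j L^{ij}_α`, a function of `3`-jets. -/
def legendre1 {m n : ℕ} (L : JetCoord m n 2 → ℝ) (α : Fin n) (i : Fin m) :
    JetCoord m n 3 → ℝ :=
  fun y => partialU (one i) α L (jetProj m n 3 2 y) - ∑ j, totalDeriv j (legendre2 L α i j) y

/-- `L^0_α = ∂L/∂u^α - ∑_i D_i L^i_α`, a priori a function of `4`-jets. -/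
def legendre0 {m n : ℕ} (L : JetCoord m n 2 → ℝ) (α : Fin n) : JetCoord m n 4 → ℝ :=
  fun y => partialU 0 α L (jetProj m n 4 2 y) - ∑ i, totalDeriv i (legendre1 L α i) y

/-- The wedge product `η_1 ∧ … ∧ η_m` of `1`-forms: `(v_1, …, v_m) ↦ det (η_i (v_j))`. -/
def wedge {m : ℕ} {V : Type*} [NormedAddCommGroup V] [NormedSpace ℝ V]
    (η : Fin m → V →L[ℝ] ℝ) : V [⋀^Fin m]→L[ℝ] ℝ :=
  ContinuousAlternatingMap.compContinuousLinearMap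
    { (Matrix.detRowAlternating : (Fin m → ℝ) [⋀^Fin m]→ₗ[ℝ] ℝ) with
      cont := Continuous.matrix_det continuous_id }
    (ContinuousLinearMap.pi η)

/-- The form `η ∧ d^{m-1}x_i`, where `d^{m-1}x_i = i(∂/∂x^i) d^m x`: it is
`dx^1 ∧ … ∧ η ∧ … ∧ dx^m` with the `1`-form `η` at the `i`-th place. -/
def wedgeDx {m n k : ℕ} (η : JetCoord m n k →L[ℝ] ℝ) (i : Fin m) :
    JetCoord m n k [⋀^Fin m]→L[ℝ] ℝ :=
  wedge (Function.update (fun j => xCoord j) i η)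

/-- The Poincaré–Cartan form
`L^i_α du^α ∧ d^{m-1}x_i + L^{ij}_α du^α_i ∧ d^{m-1}x_j
  + (L - L^i_α u^α_i - L^{ij}_α u^α_{1_i+1_j}) d^m x`. -/
def poincareCartan {m n : ℕ} (L : JetCoord m n 2 → ℝ) :
    JetCoord m n 3 → JetCoord m n 3 [⋀^Fin m]→L[ℝ] ℝ :=
  fun y =>
    ∑ α, ∑ i, legendre1 L α i y • wedgeDx (uCoord 0 α) i
    + ∑ α, ∑ i, ∑ j, legendre2 L α i j (jetProj m n 3 2 y) • wedgeDx (uCoord (one i) α) j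
    + (L (jetProj m n 3 2 y) - ∑ α, ∑ i, legendre1 L α i y * uCoord (one i) α y
        - ∑ α, ∑ i, ∑ j, legendre2 L α i j (jetProj m n 3 2 y) * uCoord (one i + one j) α y)
      • wedge (fun i => xCoord i)

/-! ### Multivector fields -/

/-- The contraction `i(X) β` of an `m`-vector `X` with an `(m+1)`-form `β`, evaluated at `v`; for
`X = v_1 ∧ … ∧ v_m` it is `β (v, v_1, …, v_m)`. (The sign convention is immaterial here, since
only the vanishing of the contraction is used.) -/
def contract {m : ℕ} {V : Type*} [NormedAddCommGroup V] [NormedSpace ℝ V]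
    (X : ⋀[ℝ]^m V) (β : V [⋀^Fin (m + 1)]→L[ℝ] ℝ) : V → ℝ :=
  fun v => exteriorPower.alternatingMapLinearEquiv (β.toAlternatingMap.curryLeft v) X

/-- The `m`-multivector field `X` is smooth and locally decomposable on `N`: near every point of
`N` it is `X_1 ∧ … ∧ X_m` for smooth vector fields `X_1, …, X_m`. -/
def IsLocallyDecomposableOn {m n k : ℕ} (X : JetCoord m n k → ⋀[ℝ]^m (JetCoord m n k))
    (N : Set (JetCoord m n k)) : Prop :=
  ∀ y ∈ N, ∃ U : Set (JetCoord m n k), IsOpen U ∧ y ∈ U ∧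
    ∃ F : Fin m → JetCoord m n k → JetCoord m n k,
      (∀ i, ContDiffOn ℝ ∞ (F i) U) ∧
      ∀ z ∈ U ∩ N, X z = exteriorPower.ιMulti ℝ m (fun i => F i z)

/-- `ψ` is a local section over the open set `U`, with values in `N`, which is an integral section
of `X`: at each of its points the tangent space to the image of `ψ` is the subspace associated
with `X`, that is, `X` is there a non-zero multiple of `∂_1ψ ∧ … ∧ ∂_mψ`. -/
def IsIntegralSection {m n k : ℕ} (X : JetCoord m n k → ⋀[ℝ]^m (JetCoord m n k))
    (N : Set (JetCoord m n k)) (U : Set (Fin m → ℝ)) (ψ : (Fin m → ℝ) → JetCoord m n k) : Prop :=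
  IsOpen U ∧ ContDiffOn ℝ ∞ ψ U ∧ (∀ x ∈ U, (ψ x).1 = x) ∧ (∀ x ∈ U, ψ x ∈ N) ∧
    ∀ x ∈ U, ∃ c : ℝ, c ≠ 0 ∧
      X (ψ x) = c • exteriorPower.ιMulti ℝ m (fun i => fderiv ℝ ψ x (Pi.single i 1))

/-- The section `ψ` is holonomic on `U`: it is the prolongation of its own projection
`x ↦ (u^α)`. -/
def IsHolonomicSection {m n k : ℕ} (U : Set (Fin m → ℝ)) (ψ : (Fin m → ℝ) → JetCoord m n k) :
    Prop :=
  ∀ x ∈ U, ψ x = prolong k (fun x' α => uCoord 0 α (ψ x')) x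

/-- The multivector field `X` is locally decomposable and holonomic on `N`: it does not vanish, it
is integrable by sections (through every point of `N` passes an integral section contained in
`N`), and its integral sections are holonomic. For an open set `N` this is the usual notion; for
a submanifold `N` it is the notion for fields along `N` that are tangent to `N`. -/
def IsHolonomicOn {m n k : ℕ} (X : JetCoord m n k → ⋀[ℝ]^m (JetCoord m n k))
    (N : Set (JetCoord m n k)) : Prop :=
  IsLocallyDecomposableOn X N ∧ (∀ y ∈ N, X y ≠ 0) ∧
    (∀ y ∈ N, ∃ U ψ, IsIntegralSection X N U ψ ∧ y.1 ∈ U ∧ ψ y.1 = y) ∧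
    ∀ U ψ, IsIntegralSection X N U ψ → IsHolonomicSection U ψ

/-- The field equation `i(X) dΘ_L = 0` at the point `y`. -/
def FieldEq {m n : ℕ} (L : JetCoord m n 2 → ℝ) (X : JetCoord m n 3 → ⋀[ℝ]^m (JetCoord m n 3))
    (y : JetCoord m n 3) : Prop :=
  ∀ v, contract (X y) (extDeriv (poincareCartan L) y) v = 0

/-- The `m`-vector `X` is tangent to the constraint functions `f^α` at `y`:
`X = v_1 ∧ … ∧ v_m` with `L(v_i) f^α = 0` for all `i` and `α`. -/
def TangencyCond {m n k : ℕ} (f : Fin n → JetCoord m n k → ℝ) (y : JetCoord m n k)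
    (X : ⋀[ℝ]^m (JetCoord m n k)) : Prop :=
  ∃ v : Fin m → JetCoord m n k, X = exteriorPower.ιMulti ℝ m v ∧
    ∀ i α, fderiv ℝ (f α) y (v i) = 0

/-! ### Fibred manifolds, adapted charts and jets -/

section Bundle

variable {m n : ℕ} {M E : Type*} [TopologicalSpace M] [ChartedSpace (Fin m → ℝ) M]
  [TopologicalSpace E] [ChartedSpace ((Fin m → ℝ) × (Fin n → ℝ)) E]

/-- `vol` is a smooth volume form on the `m`-dimensional manifold `M`. -/
def IsVolumeForm (vol : ∀ x : M, TangentSpace 𝓘(ℝ, Fin m → ℝ) x [⋀^Fin m]→ₗ[ℝ] ℝ) : Prop :=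
  (∀ x, vol x ≠ 0) ∧
  ∀ c ∈ IsManifold.maximalAtlas 𝓘(ℝ, Fin m → ℝ) ∞ M,
    ContDiffOn ℝ ∞ (fun x : Fin m → ℝ => vol (c.symm x) (fun i =>
      mfderiv 𝓘(ℝ, Fin m → ℝ) 𝓘(ℝ, Fin m → ℝ) c.symm x (Pi.single i 1 : Fin m → ℝ))) c.target

/-- Fibred coordinates `(x^i, u^α)` on an open subset of `E`, over coordinates `x^i` on an open
subset of `M`. -/
structure AdaptedChart (m n : ℕ) {M E : Type*} [TopologicalSpace M]
    [ChartedSpace (Fin m → ℝ) M] [TopologicalSpace E]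
    [ChartedSpace ((Fin m → ℝ) × (Fin n → ℝ)) E] (π : E → M) where
  /-- the coordinates on the base -/
  base : OpenPartialHomeomorph M (Fin m → ℝ)
  /-- the coordinates on the total space -/
  total : OpenPartialHomeomorph E ((Fin m → ℝ) × (Fin n → ℝ))
  base_mem : base ∈ IsManifold.maximalAtlas 𝓘(ℝ, Fin m → ℝ) ∞ M
  total_mem : total ∈ IsManifold.maximalAtlas 𝓘(ℝ, (Fin m → ℝ) × (Fin n → ℝ)) ∞ E
  mem_base : ∀ a ∈ total.source, π a ∈ base.source
  fibred : ∀ a ∈ total.source, (total a).1 = base (π a)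

/-- The chart is natural for the volume form `vol`: `vol = dx^1 ∧ … ∧ dx^m` on the base. -/
def AdaptedChart.IsNatural {π : E → M} (e : AdaptedChart m n π)
    (vol : ∀ x : M, TangentSpace 𝓘(ℝ, Fin m → ℝ) x [⋀^Fin m]→ₗ[ℝ] ℝ) : Prop :=
  ∀ x ∈ e.base.source, ∀ v : Fin m → TangentSpace 𝓘(ℝ, Fin m → ℝ) x,
    vol x v = Matrix.det (Matrix.of fun i j : Fin m =>
      (mfderiv 𝓘(ℝ, Fin m → ℝ) 𝓘(ℝ, Fin m → ℝ) e.base x (v i) : Fin m → ℝ) j)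

/-- Smooth local sections of `π` defined near `x` (the values of `toFun` far from `x` are
irrelevant). -/
structure LocalSection (m n : ℕ) {M E : Type*} [TopologicalSpace M]
    [ChartedSpace (Fin m → ℝ) M] [TopologicalSpace E]
    [ChartedSpace ((Fin m → ℝ) × (Fin n → ℝ)) E] (π : E → M) (x : M) where
  /-- the section -/
  toFun : M → E
  isSection : ∃ U : Set M, IsOpen U ∧ x ∈ U ∧
    ContMDiffOn 𝓘(ℝ, Fin m → ℝ) 𝓘(ℝ, (Fin m → ℝ) × (Fin n → ℝ)) ∞ toFun U ∧
    ∀ y ∈ U, π (toFun y) = y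

/-- The coordinate expression `x ↦ (u^α)` of a local section in an adapted chart. -/
def AdaptedChart.expr {π : E → M} (e : AdaptedChart m n π) {x : M} (φ : LocalSection m n π x) :
    (Fin m → ℝ) → Fin n → ℝ :=
  fun t => (e.total (φ.toFun (e.base.symm t))).2

/-- Two local sections have the same `k`-jet at `x`: they have the same value at `x` and, in every
adapted chart around that value, the same partial derivatives up to order `k` at `x`. -/
def jetSetoid (m n : ℕ) {M E : Type*} [TopologicalSpace M]
    [ChartedSpace (Fin m → ℝ) M] [TopologicalSpace E]
    [ChartedSpace ((Fin m → ℝ) × (Fin n → ℝ)) E] (π : E → M) (k : ℕ) (x : M) :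
    Setoid (LocalSection m n π x) where
  r φ χ := φ.toFun x = χ.toFun x ∧ ∀ e : AdaptedChart m n π, φ.toFun x ∈ e.total.source →
    prolong k (e.expr φ) (e.base x) = prolong k (e.expr χ) (e.base x)
  iseqv := ⟨fun _ => ⟨rfl, fun _ _ => rfl⟩,
    fun h => ⟨h.1.symm, fun e he => (h.2 e (h.1 ▸ he)).symm⟩,
    fun h h' => ⟨h.1.trans h'.1, fun e he => (h.2 e he).trans (h'.2 e (h.1 ▸ he))⟩⟩

/-- The `k`-jet space `J^kπ`. -/
def JetBundle (m n : ℕ) {M E : Type*} [TopologicalSpace M]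
    [ChartedSpace (Fin m → ℝ) M] [TopologicalSpace E]
    [ChartedSpace ((Fin m → ℝ) × (Fin n → ℝ)) E] (π : E → M) (k : ℕ) : Type _ :=
  Σ x : M, Quotient (jetSetoid m n π k x)

/-- The projection of `J^kπ` to `E` (it does not depend on the representative of the jet). -/
def JetBundle.toTotal {π : E → M} {k : ℕ} (p : JetBundle m n π k) : E :=
  p.2.out.toFun p.1

/-- The domain in `J^kπ` of the coordinates induced by an adapted chart. -/
def AdaptedChart.jetSource {π : E → M} (e : AdaptedChart m n π) (k : ℕ) :
    Set (JetBundle m n π k) :=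
  {p | p.toTotal ∈ e.total.source}

/-- The coordinates `(x^i, u^α_I)` of a jet in `e.jetSource k` (they do not depend on the
representative of the jet). -/
def AdaptedChart.jetCoord {π : E → M} (e : AdaptedChart m n π) {k : ℕ} (p : JetBundle m n π k) :
    JetCoord m n k :=
  prolong k (e.expr p.2.out) (e.base p.1)

/-- The range of the coordinates induced by an adapted chart on `e.jetSource k`. -/
def AdaptedChart.jetTarget {π : E → M} (e : AdaptedChart m n π) (k : ℕ) :
    Set (JetCoord m n k) :=
  {y | (y.1, fun α => uCoord 0 α y) ∈ e.total.target}

open Classical in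
/-- The coordinate expression, on `e.jetTarget k`, of a function on `J^kπ`. -/
def AdaptedChart.localRep {π : E → M} (e : AdaptedChart m n π) {k : ℕ}
    (f : JetBundle m n π k → ℝ) : JetCoord m n k → ℝ :=
  fun y => if h : ∃ p ∈ e.jetSource k, e.jetCoord p = y then f h.choose else 0

/-- `f` is a smooth function on `J^kπ`. -/
def SmoothOnJets {π : E → M} {k : ℕ} (f : JetBundle m n π k → ℝ) : Prop :=
  ∀ e : AdaptedChart m n π, ContDiffOn ℝ ∞ (e.localRep f) (e.jetTarget k)

/-- The Poincaré–Cartan form of the Lagrangian `L vol` projects onto `J^sπ`: it is the pull-back of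
a smooth form on `J^sπ`. (The form on `J^sπ` is unique, so it may be given in each chart.) -/
def Projects {π : E → M}
    (vol : ∀ x : M, TangentSpace 𝓘(ℝ, Fin m → ℝ) x [⋀^Fin m]→ₗ[ℝ] ℝ)
    (L : JetBundle m n π 2 → ℝ) (s : ℕ) : Prop :=
  ∀ e : AdaptedChart m n π, e.IsNatural vol →
    ∃ θ : JetCoord m n s → JetCoord m n s [⋀^Fin m]→L[ℝ] ℝ,
      ContDiffOn ℝ ∞ θ (e.jetTarget s) ∧
      ∀ y ∈ e.jetTarget 3, poincareCartan (e.localRep L) y =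
        (θ (jetProj m n 3 s y)).compContinuousLinearMap (jetProj m n 3 s)

/-- There is a locally decomposable holonomic multivector field `X`, defined on a neighbourhood of
the point `p` of `J^3π`, which satisfies `i(X) dΘ_L = 0` at `p`, and whose value at `p` satisfies
the condition `C`. -/
def HasSolutionAt {π : E → M} (L : JetBundle m n π 2 → ℝ) (e : AdaptedChart m n π)
    (p : JetBundle m n π 3) (C : ⋀[ℝ]^m (JetCoord m n 3) → Prop) : Prop :=
  ∃ O : Set (JetCoord m n 3), IsOpen O ∧ e.jetCoord p ∈ O ∧ O ⊆ e.jetTarget 3 ∧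
    ∃ X : JetCoord m n 3 → ⋀[ℝ]^m (JetCoord m n 3),
      IsHolonomicOn X O ∧ FieldEq (e.localRep L) X (e.jetCoord p) ∧ C (X (e.jetCoord p))

/-- There is a solution of the Euler–Lagrange equations for multivector fields on the subset `N`
of `J^3π`: a locally decomposable multivector field which is holonomic on `N` and satisfies
`i(X) dΘ_L = 0` at all points of `N`. -/
def HasSolutionOn {π : E → M} (L : JetBundle m n π 2 → ℝ) (e : AdaptedChart m n π)
    (N : Set (JetBundle m n π 3)) : Prop :=
  ∃ X : JetCoord m n 3 → ⋀[ℝ]^m (JetCoord m n 3),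
    IsHolonomicOn X (e.jetCoord '' N) ∧ ∀ p ∈ N, FieldEq (e.localRep L) X (e.jetCoord p)

end Bundle

end SecondOrderFieldTheory

end

/-!
Everything is local: in the coordinates of the given chart, `Θ_L` is a form on the set of `3`-jets
over an open subset `Ω` of `ℝ^m × ℝ^n`.

Let `w_1, …, w_m` be vectors at a `3`-jet `y` whose projections to `2`-jets are the total
derivatives `D_1, …, D_m` at `y`. A direct computation (`extDeriv_poincareCartan_vertical`) gives,
for vertical `v`,
`dΘ_L(v, w_1, …, w_m) = ∑_α u^α(v) (∂L/∂u^α - ∑_i dL^i_α(w_i))`;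
the choice of `L^i_α` and `L^{ij}_α` makes all other components of `v` disappear, and a combination
of the `w_i` contributes nothing. If `Θ_L` projects onto `J^2π`, so do its coefficients `L^i_α`
(`exists_legendre1_eq_comp`); then `dL^i_α(w_i)` depends only on the projection of `w_i`, it equals
`D_i L^i_α(y)`, and the parenthesis is the function `L^0_α` at `y`. So `i(X) dΘ_L = 0` at `y` says
`L^0_α(y) = 0` for `X = w_1 ∧ … ∧ w_m`, whatever the components of the `w_i` along `∂/∂u^α_I`,
`|I| = 3`, are (`fieldEq_iff_euler3`).

The tangent frame of a holonomic section has this property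
(`IsHolonomicSection.jetProj_fderiv`), which proves that the conditions are necessary. If
`Θ_L` projects onto `J^1π`, then `L^0_α` is a function on `J^2π`, the vectors `w_i` act on it as
`D_i`, and they annihilate it both under the tangency condition and along any integral section on
which it vanishes. This gives the conditions `D_i L^0_α = 0`.

For the converse no integrability problem has to be solved: the field `truncField`, the wedge
product of the total derivatives truncated at order three, is holonomic on every open set, because
its integral sections are exactly the prolongations of maps that are locally polynomials of degree
at most three (`cubicSection`, `isHolonomicSection_of_jetProj_fderiv`), and it solves the field
equation wherever `L^0_α = 0`.
-/

open scoped Manifold ContDiff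

noncomputable section

namespace SecondOrderFieldTheory

/-! ### Linear algebra of jet coordinates -/

section Coordinates

variable {m n k l : ℕ}

@[simp] lemma sum_one (i : Fin m) : ∑ j, one i j = 1 := by simp [one]

@[simp] lemma sum_add_one (I : Fin m → ℕ) (i : Fin m) : ∑ j, (I + one i) j = ∑ j, I j + 1 := by
  simp [Finset.sum_add_distrib]

lemma uCoord_apply {I : Fin m → ℕ} (h : ∑ i, I i ≤ k) (α : Fin n) (y : JetCoord m n k) :
    uCoord I α y = y.2 ⟨I, h⟩ α := by
  simp [uCoord, h]

lemma uCoord_of_lt {I : Fin m → ℕ} (h : k < ∑ i, I i) (α : Fin n) (y : JetCoord m n k) :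
    uCoord I α y = 0 := by
  simp [uCoord, not_le.2 h]

@[simp] lemma xCoord_apply (i : Fin m) (y : JetCoord m n k) : xCoord i y = y.1 i := rfl

@[simp] lemma jetProj_fst (y : JetCoord m n k) : (jetProj m n k l y).1 = y.1 := rfl

lemma uCoord_jetProj {I : Fin m → ℕ} (h : ∑ i, I i ≤ l) (α : Fin n) (y : JetCoord m n k) :
    uCoord I α (jetProj m n k l y) = uCoord I α y := by
  rw [uCoord_apply h]; rfl

lemma jetCoord_ext {y z : JetCoord m n k} (h1 : y.1 = z.1)
    (h2 : ∀ I : Fin m → ℕ, ∑ i, I i ≤ k → ∀ α, uCoord I α y = uCoord I α z) : y = z := by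
  refine Prod.ext h1 (funext fun I => funext fun α => ?_)
  have := h2 I.1 I.2 α
  rwa [uCoord_apply I.2, uCoord_apply I.2] at this

lemma jetProj_jetProj {j : ℕ} (h : l ≤ j) (y : JetCoord m n k) :
    jetProj m n j l (jetProj m n k j y) = jetProj m n k l y := by
  refine jetCoord_ext rfl fun I hI α => ?_
  rw [uCoord_jetProj hI, uCoord_jetProj hI, uCoord_jetProj (hI.trans h)]

@[simp] lemma totalVec_fst (i : Fin m) (y : JetCoord m n (k + 1)) :
    (totalVec i y).1 = Pi.single i 1 := rfl

lemma uCoord_totalVec {I : Fin m → ℕ} (h : ∑ i, I i ≤ k) (α : Fin n) (i : Fin m)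
    (y : JetCoord m n (k + 1)) : uCoord I α (totalVec i y) = uCoord (I + one i) α y := by
  rw [uCoord_apply h]; rfl

@[simp] lemma uVec_fst (I : Fin m → ℕ) (α : Fin n) : (uVec I α : JetCoord m n k).1 = 0 := rfl

lemma uCoord_uVec {I : Fin m → ℕ} (h : ∑ i, I i ≤ k) (α : Fin n) (J : Fin m → ℕ) (β : Fin n) :
    uCoord I α (uVec J β : JetCoord m n k) = if I = J ∧ α = β then 1 else 0 := by
  rw [uCoord_apply h]; rfl

lemma jetProj_uVec (h : l ≤ k) (J : Fin m → ℕ) (β : Fin n) :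
    jetProj m n k l (uVec J β) = uVec J β := by
  refine jetCoord_ext rfl fun I hI α => ?_
  rw [uCoord_jetProj hI, uCoord_uVec hI, uCoord_uVec (hI.trans h)]

/-- The linear part of the affine map `y ↦ totalVec i y`. -/
def totalLin (m n k : ℕ) (i : Fin m) : JetCoord m n (k + 1) →L[ℝ] JetCoord m n k :=
  (0 : JetCoord m n (k + 1) →L[ℝ] (Fin m → ℝ)).prod
    (ContinuousLinearMap.pi fun I : MultiIndex m k =>
      ContinuousLinearMap.pi fun α : Fin n => uCoord (I.1 + one i) α)

lemma totalVec_eq (i : Fin m) (y : JetCoord m n (k + 1)) :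
    totalVec i y = (Pi.single i 1, 0) + totalLin m n k i y := by
  refine Prod.ext ?_ ?_
  · simp [totalVec, totalLin]
  · simp [totalVec, totalLin]

lemma uCoord_totalLin {I : Fin m → ℕ} (h : ∑ i, I i ≤ k) (α : Fin n) (i : Fin m)
    (y : JetCoord m n (k + 1)) : uCoord I α (totalLin m n k i y) = uCoord (I + one i) α y := by
  rw [uCoord_apply h]; rfl

lemma jetProj_totalVec (h : l ≤ k) (i : Fin m) (z : JetCoord m n (k + 1)) :
    jetProj m n k l (totalVec i z) = totalVec i (jetProj m n (k + 1) (l + 1) z) := by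
  refine jetCoord_ext rfl fun I hI α => ?_
  rw [uCoord_jetProj hI, uCoord_totalVec hI, uCoord_totalVec (hI.trans h), uCoord_jetProj]
  simpa [Finset.sum_add_distrib] using hI

lemma contDiff_totalVec {r : ℕ∞ω} (i : Fin m) :
    ContDiff ℝ r (totalVec i : JetCoord m n (k + 1) → JetCoord m n k) := by
  have : (totalVec i : JetCoord m n (k + 1) → JetCoord m n k) =
      fun y => (Pi.single i 1, 0) + totalLin m n k i y := funext (totalVec_eq i)
  rw [this]
  exact contDiff_const.add (totalLin m n k i).contDiff

/-! ### Multi-indices of length at most two -/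

lemma exists_eq_add_one {I : Fin m → ℕ} (h : I ≠ 0) : ∃ J i, I = J + one i := by
  obtain ⟨i, hi⟩ := Function.ne_iff.1 h
  refine ⟨I - one i, i, funext fun j => ?_⟩
  by_cases hj : j = i
  · subst hj; simp [one] at hi ⊢; omega
  · simp [one, hj]

lemma multiIndex_cases {I : Fin m → ℕ} (h : ∑ i, I i ≤ 2) :
    I = 0 ∨ (∃ i, I = one i) ∨ ∃ i j, I = one i + one j := by
  by_cases h0 : I = 0
  · exact .inl h0
  obtain ⟨J, i, rfl⟩ := exists_eq_add_one h0
  by_cases h1 : J = 0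
  · exact .inr (.inl ⟨i, by simp [h1]⟩)
  obtain ⟨K, j, rfl⟩ := exists_eq_add_one h1
  by_cases h2 : K = 0
  · exact .inr (.inr ⟨j, i, by simp [h2]⟩)
  obtain ⟨K', j', rfl⟩ := exists_eq_add_one h2
  simp only [sum_add_one] at h
  omega

lemma one_injective : Function.Injective (one : Fin m → Fin m → ℕ) := by
  intro i j h
  by_contra hij
  have := congrFun h i
  simp [one, hij] at this

lemma one_add_one_eq_iff {a b i j : Fin m} :
    one a + one b = one i + one j ↔ (i = a ∧ j = b) ∨ (i = b ∧ j = a) := by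
  constructor
  · intro h
    by_cases hia : i = a
    · subst hia
      exact .inl ⟨rfl, (one_injective (add_left_cancel h)).symm⟩
    · have hib : i = b := by
        by_contra hib
        have := congrFun h i
        simp only [one, Pi.add_apply, Pi.single_apply, hia, hib, if_false, if_true] at this
        omega
      subst hib
      rw [add_comm] at h
      exact .inr ⟨rfl, (one_injective (add_left_cancel h)).symm⟩
  · rintro (⟨rfl, rfl⟩ | ⟨rfl, rfl⟩)
    · rfl
    · exact add_comm _ _

lemma nfac_comm (i j : Fin m) : nfac i j = nfac j i := by
  simp only [nfac, eq_comm]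

lemma nfac_ne_zero (i j : Fin m) : nfac i j ≠ 0 := by
  unfold nfac; split_ifs <;> norm_num

/-- `n(ab)` counts the ordered pairs `(i, j)` with `1_i + 1_j = 1_a + 1_b`. -/
lemma sum_ite_one_add_one (a b : Fin m) :
    ∑ i, ∑ j, (if one a + one b = one i + one j then (1 : ℝ) else 0) = nfac a b := by
  simp only [one_add_one_eq_iff]
  by_cases hab : a = b
  · subst hab
    simp [nfac, ite_and]
  · have : ∀ i j : Fin m, (if (i = a ∧ j = b) ∨ (i = b ∧ j = a) then (1 : ℝ) else 0) =
        (if i = a then if j = b then 1 else 0 else 0) +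
          (if i = b then if j = a then 1 else 0 else 0) := by
      intro i j
      by_cases h1 : i = a <;> by_cases h2 : i = b
      · exact absurd (h1.symm.trans h2) hab
      · simp [h1, hab]
      · simp [h2, Ne.symm hab]
      · simp [h1, h2]
    simp only [this, Finset.sum_add_distrib]
    simp [nfac, hab]
    norm_num

lemma one_ne_zero' (i : Fin m) : one i ≠ 0 := fun h => by
  have := sum_one i
  simp [h] at this

lemma sum_one_add_one (i j : Fin m) : ∑ l, (one i + one j) l = 2 := by
  simp [Finset.sum_add_distrib]

/-- A vertical vector in the basis `∂/∂u^α_I`. The last sum runs over ordered pairs `(i, j)`, which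
is compensated by `n(ij)`. -/
lemma vertical_eq_sum {v : JetCoord m n 2} (hv : v.1 = 0) :
    v = ∑ α, (uCoord 0 α v • uVec 0 α + ∑ i, uCoord (one i) α v • uVec (one i) α +
      ∑ i, ∑ j, (1 / nfac i j * uCoord (one i + one j) α v) • uVec (one i + one j) α) := by
  refine jetCoord_ext ?_ fun J hJ β => ?_
  · simp [hv, Prod.fst_sum]
  simp only [map_sum, map_add, map_smul, uCoord_uVec hJ, smul_eq_mul]
  rw [Finset.sum_eq_single β (fun α _ h => by simp [Ne.symm h]) (by simp)]
  rcases multiIndex_cases hJ with rfl | ⟨a, rfl⟩ | ⟨a, b, rfl⟩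
  · have h2 : ∀ i j : Fin m, (0 : Fin m → ℕ) ≠ one i + one j := fun i j h => by
      have := sum_one_add_one i j
      rw [← h] at this; simp at this
    simp [(one_ne_zero' _).symm, h2]
  · have h2 : ∀ i j : Fin m, one a ≠ one i + one j := fun i j h => by
      have := sum_one_add_one i j
      rw [← h] at this; simp at this
    simp [h2, one_ne_zero', one_injective.eq_iff]
  · have h0 : one a + one b ≠ 0 := fun h => by
      have := sum_one_add_one a b
      rw [h] at this; simp at this
    have h1 : ∀ i : Fin m, one a + one b ≠ one i := fun i h => by
      have := sum_one_add_one a b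
      rw [h] at this; simp at this
    have key : ∀ i j : Fin m, 1 / nfac i j * uCoord (one i + one j) β v *
        (if one a + one b = one i + one j then 1 else 0) =
        (1 / nfac a b * uCoord (one a + one b) β v) *
          (if one a + one b = one i + one j then 1 else 0) := by
      intro i j
      by_cases h : one a + one b = one i + one j
      · have : nfac i j = nfac a b := by
          rcases one_add_one_eq_iff.1 h with ⟨rfl, rfl⟩ | ⟨rfl, rfl⟩
          · rfl
          · exact nfac_comm _ _
        simp [← h, this]
      · simp [h]
    simp only [and_true, key, ← Finset.mul_sum, sum_ite_one_add_one]
    have := nfac_ne_zero a b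
    simp [h0, h1]
    field_simp

end Coordinates

/-! ### Total derivatives -/

section TotalDerivatives

variable {m n k l : ℕ} {Ω : Set ((Fin m → ℝ) × (Fin n → ℝ))}

/-- The set of `k`-jets (in coordinates) over the subset `Ω` of the total space. -/
def jetDomain (Ω : Set ((Fin m → ℝ) × (Fin n → ℝ))) (k : ℕ) : Set (JetCoord m n k) :=
  {y | (y.1, fun α => uCoord 0 α y) ∈ Ω}

lemma isOpen_jetDomain (hΩ : IsOpen Ω) : IsOpen (jetDomain Ω k) :=
  hΩ.preimage (f := fun y : JetCoord m n k => (y.1, fun α => uCoord 0 α y)) (by fun_prop)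

lemma jetProj_mem_jetDomain_iff (y : JetCoord m n k) :
    jetProj m n k l y ∈ jetDomain Ω l ↔ y ∈ jetDomain Ω k := by
  simp only [jetDomain, Set.mem_ofPred_eq, jetProj_fst]
  simp [uCoord_jetProj]

lemma contDiffOn_comp_jetProj {f : JetCoord m n l → ℝ} (hf : ContDiffOn ℝ ∞ f (jetDomain Ω l)) :
    ContDiffOn ℝ ∞ (fun y => f (jetProj m n k l y)) (jetDomain Ω k) :=
  hf.comp (jetProj m n k l).contDiff.contDiffOn fun y hy => (jetProj_mem_jetDomain_iff y).2 hy

lemma differentiableAt_of_contDiffOn (hΩ : IsOpen Ω) {f : JetCoord m n k → ℝ}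
    (hf : ContDiffOn ℝ ∞ f (jetDomain Ω k)) {y : JetCoord m n k} (hy : y ∈ jetDomain Ω k) :
    DifferentiableAt ℝ f y :=
  (hf.contDiffAt ((isOpen_jetDomain hΩ).mem_nhds hy)).differentiableAt (by simp)

lemma contDiffOn_fderiv_of_isOpen {V W : Type*} [NormedAddCommGroup V] [NormedSpace ℝ V]
    [NormedAddCommGroup W] [NormedSpace ℝ W] {f : V → W} {S : Set V} (hS : IsOpen S)
    (hf : ContDiffOn ℝ ∞ f S) : ContDiffOn ℝ ∞ (fderiv ℝ f) S :=
  hf.fderiv_of_isOpen hS (by simp)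

lemma contDiffOn_partialU {f : JetCoord m n k → ℝ} (hΩ : IsOpen Ω) (I : Fin m → ℕ) (α : Fin n)
    (hf : ContDiffOn ℝ ∞ f (jetDomain Ω k)) :
    ContDiffOn ℝ ∞ (partialU I α f) (jetDomain Ω k) :=
  (contDiffOn_fderiv_of_isOpen (isOpen_jetDomain hΩ) hf).clm_apply contDiffOn_const

lemma contDiffOn_totalDeriv {f : JetCoord m n k → ℝ} (hΩ : IsOpen Ω) (i : Fin m)
    (hf : ContDiffOn ℝ ∞ f (jetDomain Ω k)) :
    ContDiffOn ℝ ∞ (totalDeriv i f) (jetDomain Ω (k + 1)) :=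
  ((contDiffOn_fderiv_of_isOpen (isOpen_jetDomain hΩ) hf).comp
    (jetProj m n (k + 1) k).contDiff.contDiffOn
    fun y hy => (jetProj_mem_jetDomain_iff y).2 hy).clm_apply (contDiff_totalVec i).contDiffOn

lemma totalDeriv_comp_jetProj (h : l ≤ k) (i : Fin m) {f : JetCoord m n l → ℝ}
    {z : JetCoord m n (k + 1)} (hf : DifferentiableAt ℝ f (jetProj m n (k + 1) l z)) :
    totalDeriv i (fun y => f (jetProj m n k l y)) z =
      totalDeriv i f (jetProj m n (k + 1) (l + 1) z) := by
  rw [← jetProj_jetProj h] at hf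
  have := hf.hasFDerivAt.comp _ (jetProj m n k l).hasFDerivAt
  have h2 : fderiv ℝ (fun y => f (jetProj m n k l y)) (jetProj m n (k + 1) k z) =
      (fderiv ℝ f (jetProj m n k l (jetProj m n (k + 1) k z))).comp (jetProj m n k l) :=
    this.fderiv
  rw [totalDeriv, h2, totalDeriv, ContinuousLinearMap.comp_apply, jetProj_totalVec h,
    jetProj_jetProj h, jetProj_jetProj (Nat.le_succ l)]

lemma totalDeriv_congr (hΩ : IsOpen Ω) (i : Fin m) {f g : JetCoord m n k → ℝ}
    (h : Set.EqOn f g (jetDomain Ω k)) {z : JetCoord m n (k + 1)} (hz : z ∈ jetDomain Ω (k + 1)) :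
    totalDeriv i f z = totalDeriv i g z := by
  have := h.eventuallyEq_of_mem
    ((isOpen_jetDomain hΩ).mem_nhds ((jetProj_mem_jetDomain_iff (l := k) z).2 hz))
  rw [totalDeriv, totalDeriv, this.fderiv_eq]

lemma totalDeriv_sum {ι : Type*} (s : Finset ι) (i : Fin m) {f : ι → JetCoord m n k → ℝ}
    {z : JetCoord m n (k + 1)}
    (h : ∀ a ∈ s, DifferentiableAt ℝ (f a) (jetProj m n (k + 1) k z)) :
    totalDeriv i (fun y => ∑ a ∈ s, f a y) z = ∑ a ∈ s, totalDeriv i (f a) z := by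
  simp only [totalDeriv]
  rw [fderiv_fun_sum h]
  simp

lemma totalDeriv_sub (i : Fin m) {f g : JetCoord m n k → ℝ} {z : JetCoord m n (k + 1)}
    (hf : DifferentiableAt ℝ f (jetProj m n (k + 1) k z))
    (hg : DifferentiableAt ℝ g (jetProj m n (k + 1) k z)) :
    totalDeriv i (fun y => f y - g y) z = totalDeriv i f z - totalDeriv i g z := by
  simp only [totalDeriv]
  rw [fderiv_fun_sub hf hg]
  simp

lemma totalDeriv_const_mul (i : Fin m) (c : ℝ) {f : JetCoord m n k → ℝ} {z : JetCoord m n (k + 1)}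
    (hf : DifferentiableAt ℝ f (jetProj m n (k + 1) k z)) :
    totalDeriv i (fun y => c * f y) z = c * totalDeriv i f z := by
  simp only [totalDeriv]
  rw [fderiv_const_mul hf]
  simp

/-- The iterated total derivative in terms of the first two derivatives of `f`; both terms are
symmetric in `i` and `j`. -/
lemma totalDeriv_totalDeriv_apply (hΩ : IsOpen Ω) (i j : Fin m) {f : JetCoord m n k → ℝ}
    (hf : ContDiffOn ℝ ∞ f (jetDomain Ω k)) {z : JetCoord m n (k + 1 + 1)}
    (hz : z ∈ jetDomain Ω (k + 1 + 1)) :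
    totalDeriv i (totalDeriv j f) z =
      fderiv ℝ (fderiv ℝ f) (jetProj m n (k + 1 + 1) k z)
        (totalVec i (jetProj m n (k + 1 + 1) (k + 1) z))
        (totalVec j (jetProj m n (k + 1 + 1) (k + 1) z)) +
      fderiv ℝ f (jetProj m n (k + 1 + 1) k z) (totalLin m n k j (totalVec i z)) := by
  have hd : DifferentiableAt ℝ (fderiv ℝ f)
      (jetProj m n (k + 1) k (jetProj m n (k + 1 + 1) (k + 1) z)) := by
    refine ((contDiffOn_fderiv_of_isOpen (isOpen_jetDomain hΩ) hf).contDiffAt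
      ((isOpen_jetDomain hΩ).mem_nhds ?_)).differentiableAt (by simp)
    simpa only [jetProj_mem_jetDomain_iff] using hz
  have h1 := hd.hasFDerivAt.comp _ (jetProj m n (k + 1) k).hasFDerivAt
  have h2 : HasFDerivAt (totalVec j : JetCoord m n (k + 1) → JetCoord m n k) (totalLin m n k j)
      (jetProj m n (k + 1 + 1) (k + 1) z) := by
    have : (totalVec j : JetCoord m n (k + 1) → JetCoord m n k) =
        fun y => (Pi.single j 1, 0) + totalLin m n k j y := funext (totalVec_eq j)
    rw [this]
    exact (totalLin m n k j).hasFDerivAt.const_add _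
  have h3 : fderiv ℝ (totalDeriv j f) (jetProj m n (k + 1 + 1) (k + 1) z) = _ :=
    (h1.clm_apply h2).fderiv
  rw [totalDeriv, h3]
  simp only [Function.comp_apply, jetProj_jetProj (Nat.le_succ k), _root_.add_apply,
    ContinuousLinearMap.comp_apply, ContinuousLinearMap.flip_apply,
    jetProj_totalVec (Nat.le_succ k)]
  rw [add_comm]

lemma totalDeriv_comm (hΩ : IsOpen Ω) (i j : Fin m) {f : JetCoord m n k → ℝ}
    (hf : ContDiffOn ℝ ∞ f (jetDomain Ω k)) {z : JetCoord m n (k + 1 + 1)}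
    (hz : z ∈ jetDomain Ω (k + 1 + 1)) :
    totalDeriv i (totalDeriv j f) z = totalDeriv j (totalDeriv i f) z := by
  rw [totalDeriv_totalDeriv_apply hΩ i j hf hz, totalDeriv_totalDeriv_apply hΩ j i hf hz]
  have hc : ContDiffAt ℝ ∞ f (jetProj m n (k + 1 + 1) k z) :=
    hf.contDiffAt ((isOpen_jetDomain hΩ).mem_nhds ((jetProj_mem_jetDomain_iff z).2 hz))
  congr 1
  · exact (hc.isSymmSndFDerivAt (by simpa using ENat.LEInfty.out)).eq _ _
  · congr 1
    refine jetCoord_ext rfl fun I hI α => ?_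
    have hI' (i : Fin m) : ∑ l, (I + one i) l ≤ k + 1 := by rw [sum_add_one]; omega
    rw [uCoord_totalLin hI, uCoord_totalLin hI, uCoord_totalVec (hI' j), uCoord_totalVec (hI' i),
      add_right_comm I]

end TotalDerivatives

/-! ### The functions attached to a Lagrangian -/

section Legendre

variable {m n : ℕ} {Ω : Set ((Fin m → ℝ) × (Fin n → ℝ))} {L : JetCoord m n 2 → ℝ}

lemma contDiffOn_legendre2 (hΩ : IsOpen Ω) (hL : ContDiffOn ℝ ∞ L (jetDomain Ω 2)) (α : Fin n)
    (i j : Fin m) : ContDiffOn ℝ ∞ (legendre2 L α i j) (jetDomain Ω 2) :=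
  contDiffOn_const.mul (contDiffOn_partialU hΩ _ α hL)

lemma contDiffOn_legendre1 (hΩ : IsOpen Ω) (hL : ContDiffOn ℝ ∞ L (jetDomain Ω 2)) (α : Fin n)
    (i : Fin m) : ContDiffOn ℝ ∞ (legendre1 L α i) (jetDomain Ω 3) :=
  (contDiffOn_comp_jetProj (contDiffOn_partialU hΩ _ α hL)).sub
    (ContDiffOn.sum fun j _ => contDiffOn_totalDeriv hΩ j (contDiffOn_legendre2 hΩ hL α i j))

lemma sum_nfac_eq_sum_Ici (f : Fin m → Fin m → ℝ) (hf : ∀ i j, f i j = f j i) :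
    ∑ i, ∑ j, 1 / nfac i j * f i j = ∑ i, ∑ j ∈ Finset.Ici i, f i j := by
  have h1 : ∀ i j, 1 / nfac i j * f i j =
      (1 / 2) * (if i ≤ j then f i j else 0) + (1 / 2) * (if j ≤ i then f j i else 0) := by
    intro i j
    rcases lt_trichotomy i j with h | rfl | h
    · simp [nfac, h.le, h.ne, not_le.2 h]
    · simp [nfac]; ring
    · simp [nfac, h.le, h.ne', not_le.2 h, hf i j]
  simp only [h1, Finset.sum_add_distrib, ← Finset.mul_sum]
  rw [Finset.sum_comm (f := fun i j => if j ≤ i then f j i else 0), ← two_mul, ← mul_assoc]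
  simp only [one_div, ne_eq, OfNat.ofNat_ne_zero, not_false_eq_true, mul_inv_cancel₀, one_mul]
  refine Finset.sum_congr rfl fun i _ => ?_
  rw [← Finset.sum_filter]
  congr 1
  ext j; simp

/-- The Euler–Lagrange expression `∂L/∂u - D_i ∂L/∂u_i + ∑_{|I|=2} D_I ∂L/∂u_I`. -/
lemma legendre0_eq (hΩ : IsOpen Ω) (hL : ContDiffOn ℝ ∞ L (jetDomain Ω 2)) (α : Fin n)
    {z : JetCoord m n 4} (hz : z ∈ jetDomain Ω 4) :
    legendre0 L α z = partialU 0 α L (jetProj m n 4 2 z)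
      - ∑ i, totalDeriv i (partialU (one i) α L) (jetProj m n 4 3 z)
      + ∑ i, ∑ j ∈ Finset.Ici i, totalDeriv i (totalDeriv j (partialU (one i + one j) α L)) z := by
  have hz3 : jetProj m n 4 3 z ∈ jetDomain Ω 3 := (jetProj_mem_jetDomain_iff z).2 hz
  have hz2 : jetProj m n 4 2 z ∈ jetDomain Ω 2 := (jetProj_mem_jetDomain_iff z).2 hz
  have hP (I : Fin m → ℕ) := contDiffOn_partialU hΩ I α hL
  have h1 : ∀ i, totalDeriv i (legendre1 L α i) z =
      totalDeriv i (partialU (one i) α L) (jetProj m n 4 3 z) -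
        ∑ j, 1 / nfac i j * totalDeriv i (totalDeriv j (partialU (one i + one j) α L)) z := by
    intro i
    have hD (j : Fin m) := contDiffOn_totalDeriv hΩ j (hP (one i + one j))
    have h2 : Set.EqOn (legendre1 L α i) (fun y => partialU (one i) α L (jetProj m n 3 2 y) -
        ∑ j, 1 / nfac i j * totalDeriv j (partialU (one i + one j) α L) y) (jetDomain Ω 3) := by
      intro y hy
      have hy2 : jetProj m n 3 2 y ∈ jetDomain Ω 2 := (jetProj_mem_jetDomain_iff y).2 hy
      simp only [legendre1]
      congr 1
      refine Finset.sum_congr rfl fun j _ => ?_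
      exact totalDeriv_const_mul j _ (differentiableAt_of_contDiffOn hΩ (hP _) hy2)
    have hD' (j : Fin m) := differentiableAt_of_contDiffOn hΩ (hD j) hz3
    rw [totalDeriv_congr hΩ i h2 hz, totalDeriv_sub, totalDeriv_sum]
    · rw [totalDeriv_comp_jetProj (by norm_num) i (differentiableAt_of_contDiffOn hΩ (hP _) hz2)]
      congr 1
      exact Finset.sum_congr rfl fun j _ => totalDeriv_const_mul i _ (hD' j)
    · exact fun j _ => (hD' j).const_mul _
    · exact differentiableAt_of_contDiffOn hΩ (contDiffOn_comp_jetProj (hP (one i))) hz3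
    · exact DifferentiableAt.fun_sum fun j _ => (hD' j).const_mul _
  rw [legendre0, Finset.sum_congr rfl fun i _ => h1 i, Finset.sum_sub_distrib,
    sum_nfac_eq_sum_Ici, sub_sub_eq_add_sub, add_sub_right_comm]
  intro i j
  rw [totalDeriv_comm hΩ i j (hP _) hz, add_comm (one i)]

end Legendre

/-! ### The exterior derivative of the Poincaré–Cartan form -/

section Wedge

variable {m n k : ℕ}

lemma wedgeDx_apply (η : JetCoord m n k →L[ℝ] ℝ) {i : Fin m} {w : Fin m → JetCoord m n k}
    (hw : ∀ j l, l ≠ i → (w j).1 l = if j = l then 1 else 0) : wedgeDx η i w = η (w i) := by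
  have h : wedgeDx η i w = ((1 : Matrix (Fin m) (Fin m) ℝ).updateCol i (fun j => η (w j))).det := by
    change Matrix.det (fun j l => Function.update (fun j => xCoord j) i η l (w j)) = _
    congr 1
    ext j l
    by_cases hl : l = i
    · subst hl; simp
    · simp [hl, hw, Matrix.one_apply]
  rw [h, ← Matrix.cramer_apply, Matrix.cramer_one, Module.End.one_apply]

lemma wedgeDx_apply_frame (η : JetCoord m n k →L[ℝ] ℝ) (i : Fin m) {w : Fin m → JetCoord m n k}
    (hw : ∀ j, (w j).1 = Pi.single j 1) : wedgeDx η i w = η (w i) :=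
  wedgeDx_apply η fun j l _ => by rw [hw, Pi.single_apply]; simp only [eq_comm]

lemma wedgeDx_apply_update (η : JetCoord m n k →L[ℝ] ℝ) (i : Fin m) {w : Fin m → JetCoord m n k}
    (hw : ∀ j, (w j).1 = Pi.single j 1) {v : JetCoord m n k} (hv : v.1 = 0) (a : Fin m) :
    wedgeDx η i (Function.update w a v) = if i = a then η v else 0 := by
  split_ifs with h
  · subst h
    rw [wedgeDx_apply, Function.update_self]
    intro j l hl
    by_cases hj : j = i
    · subst hj; simp [hv, Ne.symm hl]
    · simp [hj, hw, Pi.single_apply, eq_comm]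
  · change Matrix.det (fun j l => Function.update (fun j => xCoord j) i η l
      (Function.update w a v j)) = 0
    refine Matrix.det_eq_zero_of_column_eq_zero a fun j => ?_
    by_cases hj : j = a
    · subst hj; simp [hv, Ne.symm h]
    · simp [Ne.symm h, hj, hw, Ne.symm hj]

lemma wedge_xCoord_apply_frame {w : Fin m → JetCoord m n k}
    (hw : ∀ j, (w j).1 = Pi.single j 1) : wedge (fun i => xCoord i) w = 1 := by
  change Matrix.det (fun j l => xCoord l (w j)) = 1
  rw [← Matrix.det_one (R := ℝ) (n := Fin m)]
  congr 1
  ext j l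
  simp [hw, Matrix.one_apply, Pi.single_apply, eq_comm]

lemma wedge_xCoord_apply_update (w : Fin m → JetCoord m n k)
    {v : JetCoord m n k} (hv : v.1 = 0) (a : Fin m) :
    wedge (fun i => xCoord i) (Function.update w a v) = 0 := by
  change Matrix.det (fun j l => xCoord l (Function.update w a v j)) = 0
  exact Matrix.det_eq_zero_of_row_eq_zero a fun l => by simp [hv]

end Wedge

lemma extDeriv_apply_cons {m : ℕ} {V : Type*} [NormedAddCommGroup V] [NormedSpace ℝ V]
    {β : V → V [⋀^Fin m]→L[ℝ] ℝ} {y : V} (hβ : DifferentiableAt ℝ β y) (v : V) (w : Fin m → V) :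
    extDeriv β y (Fin.cons v w : Fin (m + 1) → V) =
      fderiv ℝ (fun z => β z w) y v -
        ∑ i, fderiv ℝ (fun z => β z (Function.update w i v)) y (w i) := by
  rw [extDeriv_apply hβ, Fin.sum_univ_succ, sub_eq_add_neg, ← Finset.sum_neg_distrib]
  congr 1
  · simp
  refine Finset.sum_congr rfl fun i _ => ?_
  obtain _ | m := m
  · exact i.elim0
  have key : ∀ z, β z (Function.update w i v) =
      (-1) ^ (i : ℕ) * β z (i.succ.removeNth (Fin.cons v w : Fin (m + 2) → V)) := by
    intro z
    have h1 := (β z).toAlternatingMap.map_insertNth i v (i.removeNth w)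
    rw [Fin.insertNth_removeNth] at h1
    have h2 : i.succ.removeNth (Fin.cons v w : Fin (m + 2) → V) =
        Matrix.vecCons v (i.removeNth w) := by
      ext1 j
      refine Fin.cases ?_ (fun j => ?_) j
      · simp [Fin.removeNth]
      · simp [Fin.removeNth]
    rw [h2]
    simpa using h1
  simp only [key]
  have hd : DifferentiableAt ℝ
      (fun z => β z (i.succ.removeNth (Fin.cons v w : Fin (m + 2) → V))) y :=
    ((ContinuousAlternatingMap.apply ℝ V ℝ
      (i.succ.removeNth (Fin.cons v w : Fin (m + 2) → V))).differentiableAt (x := β y)).comp y hβ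
  rw [fderiv_const_mul hd]
  simp [pow_succ]

section PoincareCartan

variable {m n : ℕ} {Ω : Set ((Fin m → ℝ) × (Fin n → ℝ))} {L : JetCoord m n 2 → ℝ}

lemma poincareCartan_apply_frame (y : JetCoord m n 3) {w : Fin m → JetCoord m n 3}
    (hw : ∀ j, (w j).1 = Pi.single j 1) :
    poincareCartan L y w =
      ∑ α, ∑ i, legendre1 L α i y * uCoord 0 α (w i) +
      ∑ α, ∑ i, ∑ j, legendre2 L α i j (jetProj m n 3 2 y) * uCoord (one i) α (w j) +
      (L (jetProj m n 3 2 y) - ∑ α, ∑ i, legendre1 L α i y * uCoord (one i) α y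
        - ∑ α, ∑ i, ∑ j, legendre2 L α i j (jetProj m n 3 2 y) * uCoord (one i + one j) α y) := by
  simp [poincareCartan, ContinuousAlternatingMap.sum_apply, wedgeDx_apply_frame _ _ hw,
    wedge_xCoord_apply_frame hw]

lemma poincareCartan_apply_update (y : JetCoord m n 3) {w : Fin m → JetCoord m n 3}
    (hw : ∀ j, (w j).1 = Pi.single j 1) {v : JetCoord m n 3} (hv : v.1 = 0) (a : Fin m) :
    poincareCartan L y (Function.update w a v) =
      ∑ α, legendre1 L α a y * uCoord 0 α v +
      ∑ α, ∑ i, legendre2 L α i a (jetProj m n 3 2 y) * uCoord (one i) α v := by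
  simp [poincareCartan, ContinuousAlternatingMap.sum_apply, wedgeDx_apply_update _ _ hw hv,
    wedge_xCoord_apply_update _ hv]

lemma differentiableAt_poincareCartan (hΩ : IsOpen Ω) (hL : ContDiffOn ℝ ∞ L (jetDomain Ω 2))
    {y : JetCoord m n 3} (hy : y ∈ jetDomain Ω 3) : DifferentiableAt ℝ (poincareCartan L) y := by
  have h1 (α : Fin n) (i : Fin m) : DifferentiableAt ℝ (legendre1 L α i) y :=
    differentiableAt_of_contDiffOn hΩ (contDiffOn_legendre1 hΩ hL α i) hy
  have h2 (α : Fin n) (i j : Fin m) :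
      DifferentiableAt ℝ (fun y => legendre2 L α i j (jetProj m n 3 2 y)) y :=
    differentiableAt_of_contDiffOn hΩ
      (contDiffOn_comp_jetProj (contDiffOn_legendre2 hΩ hL α i j)) hy
  have h0 : DifferentiableAt ℝ (fun y => L (jetProj m n 3 2 y)) y :=
    differentiableAt_of_contDiffOn hΩ (contDiffOn_comp_jetProj hL) hy
  have hu (I : Fin m → ℕ) (α : Fin n) :
      DifferentiableAt ℝ (fun y : JetCoord m n 3 => uCoord I α y) y := (uCoord I α).differentiableAt
  refine ((DifferentiableAt.fun_sum fun α _ => DifferentiableAt.fun_sum fun i _ =>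
    (h1 α i).smul_const _).add (DifferentiableAt.fun_sum fun α _ => DifferentiableAt.fun_sum
      fun i _ => DifferentiableAt.fun_sum fun j _ => (h2 α i j).smul_const _)).add
    (DifferentiableAt.smul_const ((h0.sub ?_).sub ?_) _)
  · exact DifferentiableAt.fun_sum fun α _ => DifferentiableAt.fun_sum fun i _ =>
      (h1 α i).mul (hu _ _)
  · exact DifferentiableAt.fun_sum fun α _ => DifferentiableAt.fun_sum fun i _ =>
      DifferentiableAt.fun_sum fun j _ => (h2 α i j).mul (hu _ _)

/-- The contraction of `dΘ_L` with a frame `w` whose projection to `2`-jets is holonomic, evaluated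
on a vertical vector `v`: only the components `∂/∂u^α` of `v` contribute. The terms in `∂/∂u^α_i`
cancel by the definition of `L^i_α`, those in `∂/∂u^α_I`, `|I| = 2`, by that of `L^{ij}_α`. -/
lemma extDeriv_poincareCartan_vertical (hΩ : IsOpen Ω) (hL : ContDiffOn ℝ ∞ L (jetDomain Ω 2))
    {y : JetCoord m n 3} (hy : y ∈ jetDomain Ω 3) {w : Fin m → JetCoord m n 3}
    (hw : ∀ i, jetProj m n 3 2 (w i) = totalVec i y) {v : JetCoord m n 3} (hv : v.1 = 0) :
    extDeriv (poincareCartan L) y (Fin.cons v w : Fin (m + 1) → JetCoord m n 3) =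
      ∑ α, uCoord 0 α v * (partialU 0 α L (jetProj m n 3 2 y) -
        ∑ i, fderiv ℝ (legendre1 L α i) y (w i)) := by
  have hw1 : ∀ j, (w j).1 = Pi.single j 1 := fun j => by
    rw [← jetProj_fst (l := 2) (w j), hw, totalVec_fst]
  have hwu {I : Fin m → ℕ} (hI : ∑ i, I i ≤ 2) (α : Fin n) (i : Fin m) :
      uCoord I α (w i) = uCoord (I + one i) α y := by
    rw [← uCoord_jetProj hI, hw, uCoord_totalVec hI]
  have hy2 : jetProj m n 3 2 y ∈ jetDomain Ω 2 := (jetProj_mem_jetDomain_iff y).2 hy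
  have hA (α : Fin n) (i : Fin m) : HasFDerivAt (legendre1 L α i)
      (fderiv ℝ (legendre1 L α i) y) y :=
    (differentiableAt_of_contDiffOn hΩ (contDiffOn_legendre1 hΩ hL α i) hy).hasFDerivAt
  have hB (α : Fin n) (i j : Fin m) :
      HasFDerivAt (fun y => legendre2 L α i j (jetProj m n 3 2 y))
        ((fderiv ℝ (legendre2 L α i j) (jetProj m n 3 2 y)).comp (jetProj m n 3 2)) y :=
    (differentiableAt_of_contDiffOn hΩ (contDiffOn_legendre2 hΩ hL α i j)
      hy2).hasFDerivAt.comp y (jetProj m n 3 2).hasFDerivAt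
  have h0 : HasFDerivAt (fun y => L (jetProj m n 3 2 y))
      ((fderiv ℝ L (jetProj m n 3 2 y)).comp (jetProj m n 3 2)) y :=
    (differentiableAt_of_contDiffOn hΩ hL hy2).hasFDerivAt.comp y (jetProj m n 3 2).hasFDerivAt
  rw [extDeriv_apply_cons (differentiableAt_poincareCartan hΩ hL hy)]
  simp only [poincareCartan_apply_frame _ hw1, poincareCartan_apply_update _ hw1 hv]
  -- the derivative of the coefficients in the direction `v`
  have e1 := (((HasFDerivAt.fun_sum (u := Finset.univ) fun α _ =>
      HasFDerivAt.fun_sum (u := Finset.univ) fun i _ =>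
        (hA α i).mul_const (uCoord 0 α (w i))).add
    (HasFDerivAt.fun_sum (u := Finset.univ) fun α _ =>
      HasFDerivAt.fun_sum (u := Finset.univ) fun i _ =>
        HasFDerivAt.fun_sum (u := Finset.univ) fun j _ =>
        (hB α i j).mul_const (uCoord (one i) α (w j)))).add
    ((h0.sub (HasFDerivAt.fun_sum (u := Finset.univ) fun α _ =>
      HasFDerivAt.fun_sum (u := Finset.univ) fun i _ =>
        (hA α i).mul (uCoord (one i) α).hasFDerivAt)).sub
      (HasFDerivAt.fun_sum (u := Finset.univ) fun α _ =>
      HasFDerivAt.fun_sum (u := Finset.univ) fun i _ =>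
        HasFDerivAt.fun_sum (u := Finset.univ) fun j _ =>
        (hB α i j).mul (uCoord (one i + one j) α).hasFDerivAt))).fderiv
  have e2 (a : Fin m) := ((HasFDerivAt.fun_sum (u := Finset.univ) fun α _ =>
        (hA α a).mul_const (uCoord 0 α v)).add
    (HasFDerivAt.fun_sum (u := Finset.univ) fun α _ =>
      HasFDerivAt.fun_sum (u := Finset.univ) fun i _ =>
        (hB α i a).mul_const (uCoord (one i) α v))).fderiv
  have e1' := DFunLike.congr_fun e1 v
  have e2' (a : Fin m) := DFunLike.congr_fun (e2 a) (w a)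
  refine (congrArg₂ (· - ·) e1' (Finset.sum_congr rfl fun a _ => e2' a)).trans ?_
  have hv1 (i : Fin m) (α : Fin n) :
      uCoord (one i) α (jetProj m n 3 2 v) = uCoord (one i) α v := uCoord_jetProj (by simp) α v
  have hv2 (i j : Fin m) (α : Fin n) :
      uCoord (one i + one j) α (jetProj m n 3 2 v) = uCoord (one i + one j) α v :=
    uCoord_jetProj (sum_one_add_one i j).le α v
  have hw0 (α : Fin n) (i : Fin m) : uCoord 0 α (w i) = uCoord (one i) α y := by
    simpa using hwu (I := 0) (by simp) α i
  have hw1' (j : Fin m) (α : Fin n) (i : Fin m) :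
      uCoord (one j) α (w i) = uCoord (one j + one i) α y := hwu (by simp) α i
  have hleg (α : Fin n) (i : Fin m) : legendre1 L α i y =
      partialU (one i) α L (jetProj m n 3 2 y) -
        ∑ j, fderiv ℝ (legendre2 L α i j) (jetProj m n 3 2 y) (totalVec j y) := rfl
  have hLv : fderiv ℝ L (jetProj m n 3 2 y) (jetProj m n 3 2 v) =
      ∑ α, (uCoord 0 α v * partialU 0 α L (jetProj m n 3 2 y) +
        ∑ i, uCoord (one i) α v * partialU (one i) α L (jetProj m n 3 2 y) +
        ∑ i, ∑ j, uCoord (one i + one j) α v * legendre2 L α i j (jetProj m n 3 2 y)) := by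
    conv_lhs => rw [vertical_eq_sum (v := jetProj m n 3 2 v) hv]
    simp only [map_sum, map_add, map_smul, smul_eq_mul]
    refine Finset.sum_congr rfl fun α _ => ?_
    rw [uCoord_jetProj (by simp)]
    simp only [hv1, hv2, legendre2, partialU]
    congr 1
    refine Finset.sum_congr rfl fun i _ => Finset.sum_congr rfl fun j _ => ?_
    ring
  simp only [_root_.add_apply, _root_.sub_apply, _root_.smul_apply, _root_.sum_apply,
    ContinuousLinearMap.comp_apply, smul_eq_mul, hw, hLv, hw0, hw1']
  have hlegu (α : Fin n) (i : Fin m) : legendre1 L α i y * uCoord (one i) α v =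
      uCoord (one i) α v * partialU (one i) α L (jetProj m n 3 2 y) -
        ∑ j, uCoord (one i) α v *
          fderiv ℝ (legendre2 L α i j) (jetProj m n 3 2 y) (totalVec j y) := by
    rw [hleg, mul_comm, mul_sub, Finset.mul_sum]
  have hL2 (α : Fin n) (i j : Fin m) :
      legendre2 L α i j (jetProj m n 3 2 y) * uCoord (one i + one j) α v =
        uCoord (one i + one j) α v * legendre2 L α i j (jetProj m n 3 2 y) := mul_comm _ _
  have s1 : ∑ i, ∑ α, uCoord 0 α v * fderiv ℝ (legendre1 L α i) y (w i) =
      ∑ α, ∑ i, uCoord 0 α v * fderiv ℝ (legendre1 L α i) y (w i) := Finset.sum_comm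
  have s2 : ∑ j, ∑ α, ∑ i, uCoord (one i) α v *
        fderiv ℝ (legendre2 L α i j) (jetProj m n 3 2 y) (totalVec j y) =
      ∑ α, ∑ i, ∑ j, uCoord (one i) α v *
        fderiv ℝ (legendre2 L α i j) (jetProj m n 3 2 y) (totalVec j y) := by
    rw [Finset.sum_comm]
    exact Finset.sum_congr rfl fun α _ => Finset.sum_comm
  simp only [Finset.sum_add_distrib, hlegu, hL2, s1, s2, mul_sub, Finset.sum_sub_distrib,
    Finset.mul_sum]
  ring

end PoincareCartan

/-! ### The field equation for semi-holonomic decomposable multivectors -/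

section FieldEquation

variable {m n : ℕ} {Ω : Set ((Fin m → ℝ) × (Fin n → ℝ))} {L : JetCoord m n 2 → ℝ}

lemma contract_smul_ιMulti {V : Type*} [NormedAddCommGroup V] [NormedSpace ℝ V] (c : ℝ)
    (w : Fin m → V) (β : V [⋀^Fin (m + 1)]→L[ℝ] ℝ) (v : V) :
    contract (c • exteriorPower.ιMulti ℝ m w) β v =
      c * β (Fin.cons v w : Fin (m + 1) → V) := by
  rw [contract, map_smul, exteriorPower.alternatingMapLinearEquiv_apply_ιMulti]
  rfl

/-- Every vector is the sum of a combination of the frame `w`, on which the contraction vanishes,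
and of a vertical vector. -/
lemma apply_cons_eq_vertical {k : ℕ} (β : JetCoord m n k [⋀^Fin (m + 1)]→L[ℝ] ℝ)
    {w : Fin m → JetCoord m n k} (v : JetCoord m n k) :
    β (Fin.cons v w : Fin (m + 1) → JetCoord m n k) =
      β (Fin.cons (v - ∑ i, v.1 i • w i) w : Fin (m + 1) → JetCoord m n k) := by
  let T : JetCoord m n k →ₗ[ℝ] ℝ :=
    { toFun := fun u => β.toAlternatingMap.curryLeft u w
      map_add' := by simp
      map_smul' := by simp }
  have h0 (i : Fin m) : T (w i) = 0 :=
    β.map_eq_zero_of_eq (Fin.cons (w i) w : Fin (m + 1) → JetCoord m n k) (i := 0) (j := i.succ)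
      (by simp) (Fin.succ_ne_zero i).symm
  change T v = T (v - ∑ i, v.1 i • w i)
  simp [h0]

lemma fieldEq_iff (hΩ : IsOpen Ω) (hL : ContDiffOn ℝ ∞ L (jetDomain Ω 2))
    {y : JetCoord m n 3} (hy : y ∈ jetDomain Ω 3) {w : Fin m → JetCoord m n 3}
    (hw : ∀ i, jetProj m n 3 2 (w i) = totalVec i y)
    {X : JetCoord m n 3 → ⋀[ℝ]^m (JetCoord m n 3)} {c : ℝ} (hc : c ≠ 0)
    (hX : X y = c • exteriorPower.ιMulti ℝ m w) :
    FieldEq L X y ↔ ∀ α, partialU 0 α L (jetProj m n 3 2 y) -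
        ∑ i, fderiv ℝ (legendre1 L α i) y (w i) = 0 := by
  have hw1 : ∀ j, (w j).1 = Pi.single j 1 := fun j => by
    rw [← jetProj_fst (l := 2) (w j), hw, totalVec_fst]
  simp only [FieldEq, hX, contract_smul_ιMulti, mul_eq_zero, hc, false_or]
  constructor
  · intro h α
    have := h (uVec 0 α)
    rw [extDeriv_poincareCartan_vertical hΩ hL hy hw rfl, Finset.sum_eq_single α] at this
    · simpa [uCoord_uVec] using this
    · intro β _ hβ
      simp [uCoord_uVec, hβ]
    · simp
  · intro h v
    rw [apply_cons_eq_vertical, extDeriv_poincareCartan_vertical hΩ hL hy hw]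
    · exact Finset.sum_eq_zero fun α _ => by rw [h α, mul_zero]
    · ext j
      simp [Prod.fst_sum, hw1, Finset.sum_apply, Pi.single_apply]

/-! ### Projectable Poincaré–Cartan forms -/

/-- The coefficient `L^i_α` is the value of `Θ_L` on `∂_1, …, ∂/∂u^α, …, ∂_m`, hence projects
together with `Θ_L`. -/
lemma exists_legendre1_eq_comp {s : ℕ} (hs : s ≤ 3)
    {θ : JetCoord m n s → JetCoord m n s [⋀^Fin m]→L[ℝ] ℝ}
    (hθ : ContDiffOn ℝ ∞ θ (jetDomain Ω s))
    (h : ∀ y ∈ jetDomain Ω 3, poincareCartan L y =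
        (θ (jetProj m n 3 s y)).compContinuousLinearMap (jetProj m n 3 s)) :
    ∃ g : Fin n → Fin m → JetCoord m n s → ℝ, (∀ α i, ContDiffOn ℝ ∞ (g α i) (jetDomain Ω s)) ∧
      ∀ α i, ∀ y ∈ jetDomain Ω 3, legendre1 L α i y = g α i (jetProj m n 3 s y) := by
  let w (k : ℕ) (α : Fin n) (i : Fin m) : Fin m → JetCoord m n k :=
    Function.update (fun j => (Pi.single j 1, 0)) i (uVec 0 α)
  refine ⟨fun α i y => θ y (w s α i), fun α i => ?_, fun α i y hy => ?_⟩
  · exact ((ContinuousAlternatingMap.apply ℝ (JetCoord m n s) ℝ (w s α i)).contDiff).comp_contDiffOn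
      hθ
  · have h1 : poincareCartan L y (w 3 α i) = legendre1 L α i y := by
      rw [poincareCartan_apply_update _ (fun j => rfl) rfl, Finset.sum_eq_single α,
        Finset.sum_eq_zero]
      · simp [uCoord_uVec]
      · intro β _
        refine Finset.sum_eq_zero fun j _ => ?_
        rw [uCoord_uVec (by simp), if_neg (fun h => one_ne_zero' j h.1), mul_zero]
      · intro β _ hβ
        simp [uCoord_uVec, hβ]
      · simp
    have h2 : ∀ j, jetProj m n 3 s (w 3 α i j) = w s α i j := by
      intro j
      by_cases hj : j = i
      · subst hj
        simp only [w, Function.update_self]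
        exact jetProj_uVec hs 0 α
      · simp only [w, Function.update_of_ne hj]
        refine jetCoord_ext rfl fun I hI β => ?_
        rw [uCoord_jetProj hI, uCoord_apply hI, uCoord_apply (hI.trans hs)]
        rfl
    rw [← h1, h y hy, ContinuousAlternatingMap.compContinuousLinearMap_apply]
    exact congrArg _ (funext h2)

/-- The function `∂L/∂u^α - ∑_i D_i g^i_α` of `3`-jets; it represents `L^0_α` when `L^i_α` is the
pull-back of the function `g^i_α` of `2`-jets. -/
def euler3 (L : JetCoord m n 2 → ℝ) (g : Fin n → Fin m → JetCoord m n 2 → ℝ) (α : Fin n) :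
    JetCoord m n 3 → ℝ :=
  fun y => partialU 0 α L (jetProj m n 3 2 y) - ∑ i, totalDeriv i (g α i) y

/-- The function `∂L/∂u^α - ∑_i D_i g^i_α` of `2`-jets; it represents `L^0_α` when `L^i_α` is the
pull-back of the function `g^i_α` of `1`-jets. -/
def euler2 (L : JetCoord m n 2 → ℝ) (g : Fin n → Fin m → JetCoord m n 1 → ℝ) (α : Fin n) :
    JetCoord m n 2 → ℝ :=
  fun y => partialU 0 α L y - ∑ i, totalDeriv i (g α i) y

lemma contDiffOn_euler3 (hΩ : IsOpen Ω) (hL : ContDiffOn ℝ ∞ L (jetDomain Ω 2))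
    {g : Fin n → Fin m → JetCoord m n 2 → ℝ}
    (hg : ∀ α i, ContDiffOn ℝ ∞ (g α i) (jetDomain Ω 2)) (α : Fin n) :
    ContDiffOn ℝ ∞ (euler3 L g α) (jetDomain Ω 3) :=
  (contDiffOn_comp_jetProj (contDiffOn_partialU hΩ 0 α hL)).sub
    (ContDiffOn.sum fun i _ => contDiffOn_totalDeriv hΩ i (hg α i))

lemma contDiffOn_euler2 (hΩ : IsOpen Ω) (hL : ContDiffOn ℝ ∞ L (jetDomain Ω 2))
    {g : Fin n → Fin m → JetCoord m n 1 → ℝ}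
    (hg : ∀ α i, ContDiffOn ℝ ∞ (g α i) (jetDomain Ω 1)) (α : Fin n) :
    ContDiffOn ℝ ∞ (euler2 L g α) (jetDomain Ω 2) :=
  (contDiffOn_partialU hΩ 0 α hL).sub
    (ContDiffOn.sum fun i _ => contDiffOn_totalDeriv hΩ i (hg α i))

lemma euler3_comp_jetProj (hΩ : IsOpen Ω) {g : Fin n → Fin m → JetCoord m n 1 → ℝ}
    (hg : ∀ α i, ContDiffOn ℝ ∞ (g α i) (jetDomain Ω 1)) (α : Fin n)
    {y : JetCoord m n 3} (hy : y ∈ jetDomain Ω 3) :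
    euler3 L (fun α i z => g α i (jetProj m n 2 1 z)) α y = euler2 L g α (jetProj m n 3 2 y) := by
  rw [euler3, euler2]
  congr 1
  refine Finset.sum_congr rfl fun i _ => ?_
  exact totalDeriv_comp_jetProj (by norm_num) i (differentiableAt_of_contDiffOn hΩ (hg α i)
    ((jetProj_mem_jetDomain_iff y).2 hy))

lemma legendre0_eq_euler3 (hΩ : IsOpen Ω) {g : Fin n → Fin m → JetCoord m n 2 → ℝ}
    (hg : ∀ α i, ContDiffOn ℝ ∞ (g α i) (jetDomain Ω 2))
    (hLg : ∀ α i, ∀ y ∈ jetDomain Ω 3, legendre1 L α i y = g α i (jetProj m n 3 2 y))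
    (α : Fin n) {z : JetCoord m n 4} (hz : z ∈ jetDomain Ω 4) :
    legendre0 L α z = euler3 L g α (jetProj m n 4 3 z) := by
  rw [legendre0, euler3, jetProj_jetProj (by norm_num)]
  congr 1
  refine Finset.sum_congr rfl fun i _ => ?_
  rw [totalDeriv_congr hΩ i (hLg α i) hz]
  exact totalDeriv_comp_jetProj (by norm_num) i (differentiableAt_of_contDiffOn hΩ (hg α i)
    ((jetProj_mem_jetDomain_iff z).2 hz))

lemma fieldEq_iff_euler3 (hΩ : IsOpen Ω) (hL : ContDiffOn ℝ ∞ L (jetDomain Ω 2))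
    {g : Fin n → Fin m → JetCoord m n 2 → ℝ}
    (hg : ∀ α i, ContDiffOn ℝ ∞ (g α i) (jetDomain Ω 2))
    (hLg : ∀ α i, ∀ y ∈ jetDomain Ω 3, legendre1 L α i y = g α i (jetProj m n 3 2 y))
    {y : JetCoord m n 3} (hy : y ∈ jetDomain Ω 3) {w : Fin m → JetCoord m n 3}
    (hw : ∀ i, jetProj m n 3 2 (w i) = totalVec i y)
    {X : JetCoord m n 3 → ⋀[ℝ]^m (JetCoord m n 3)} {c : ℝ} (hc : c ≠ 0)
    (hX : X y = c • exteriorPower.ιMulti ℝ m w) :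
    FieldEq L X y ↔ ∀ α, euler3 L g α y = 0 := by
  rw [fieldEq_iff hΩ hL hy hw hc hX]
  refine forall_congr' fun α => ?_
  rw [euler3]
  have : ∀ i, fderiv ℝ (legendre1 L α i) y (w i) = totalDeriv i (g α i) y := by
    intro i
    have hd : DifferentiableAt ℝ (g α i) (jetProj m n 3 2 y) :=
      differentiableAt_of_contDiffOn hΩ (hg α i) ((jetProj_mem_jetDomain_iff y).2 hy)
    have h1 := (show Set.EqOn (legendre1 L α i) (fun y => g α i (jetProj m n 3 2 y))
      (jetDomain Ω 3) from hLg α i).eventuallyEq_of_mem ((isOpen_jetDomain hΩ).mem_nhds hy)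
    have h2 := (hd.hasFDerivAt.comp y (jetProj m n 3 2).hasFDerivAt).congr_of_eventuallyEq h1
    rw [h2.fderiv, ContinuousLinearMap.comp_apply, hw]
    rfl
  simp only [this]

end FieldEquation

/-! ### Partial derivatives and prolongations -/

section Prolongation

variable {m n k : ℕ} {U : Set (Fin m → ℝ)}

lemma contDiffOn_pderiv (hU : IsOpen U) (i : Fin m) {f : (Fin m → ℝ) → ℝ}
    (hf : ContDiffOn ℝ ∞ f U) : ContDiffOn ℝ ∞ (pderiv i f) U :=
  (contDiffOn_fderiv_of_isOpen hU hf).clm_apply contDiffOn_const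

lemma pderiv_congr (hU : IsOpen U) (i : Fin m) {f g : (Fin m → ℝ) → ℝ} (h : Set.EqOn f g U) :
    Set.EqOn (pderiv i f) (pderiv i g) U := fun x hx => by
  rw [pderiv, pderiv, (h.eventuallyEq_of_mem (hU.mem_nhds hx)).fderiv_eq]

lemma pderiv_comm (hU : IsOpen U) (i j : Fin m) {f : (Fin m → ℝ) → ℝ}
    (hf : ContDiffOn ℝ ∞ f U) :
    Set.EqOn (pderiv i (pderiv j f)) (pderiv j (pderiv i f)) U := by
  intro x hx
  have hd : DifferentiableAt ℝ (fderiv ℝ f) x :=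
    ((contDiffOn_fderiv_of_isOpen hU hf).contDiffAt (hU.mem_nhds hx)).differentiableAt (by simp)
  have h (i j : Fin m) : pderiv i (pderiv j f) x =
      fderiv ℝ (fderiv ℝ f) x (Pi.single i 1) (Pi.single j 1) := by
    unfold pderiv
    rw [fderiv_clm_apply hd (differentiableAt_const _)]
    simp
  rw [h, h]
  exact ((hf.contDiffAt (hU.mem_nhds hx)).isSymmSndFDerivAt
    (by simpa using ENat.LEInfty.out)).eq _ _

lemma contDiffOn_pderiv_iterate (hU : IsOpen U) (i : Fin m) {f : (Fin m → ℝ) → ℝ}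
    (hf : ContDiffOn ℝ ∞ f U) (r : ℕ) : ContDiffOn ℝ ∞ ((pderiv i)^[r] f) U := by
  induction r with
  | zero => exact hf
  | succ r ih =>
    rw [Function.iterate_succ_apply']
    exact contDiffOn_pderiv hU i ih

lemma pderiv_iterate_congr (hU : IsOpen U) (i : Fin m) {f g : (Fin m → ℝ) → ℝ}
    (h : Set.EqOn f g U) (r : ℕ) : Set.EqOn ((pderiv i)^[r] f) ((pderiv i)^[r] g) U := by
  induction r with
  | zero => exact h
  | succ r ih =>
    rw [Function.iterate_succ_apply', Function.iterate_succ_apply']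
    exact pderiv_congr hU i ih

lemma pderiv_iterate_comm (hU : IsOpen U) (i j : Fin m) {f : (Fin m → ℝ) → ℝ}
    (hf : ContDiffOn ℝ ∞ f U) (r : ℕ) :
    Set.EqOn ((pderiv j)^[r] (pderiv i f)) (pderiv i ((pderiv j)^[r] f)) U := by
  induction r with
  | zero => exact Set.eqOn_refl _ _
  | succ r ih =>
    rw [Function.iterate_succ_apply', Function.iterate_succ_apply']
    exact (pderiv_congr hU j ih).trans
      (pderiv_comm hU j i (contDiffOn_pderiv_iterate hU j hf r))

lemma contDiffOn_foldr_pderiv (hU : IsOpen U) (I : Fin m → ℕ) {f : (Fin m → ℝ) → ℝ}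
    (hf : ContDiffOn ℝ ∞ f U) (l : List (Fin m)) :
    ContDiffOn ℝ ∞ (l.foldr (fun i g => (pderiv i)^[I i] g) f) U := by
  induction l with
  | nil => exact hf
  | cons a l ih => exact contDiffOn_pderiv_iterate hU a ih _

lemma foldr_pderiv_add_one (hU : IsOpen U) (I : Fin m → ℕ) (i : Fin m) {f : (Fin m → ℝ) → ℝ}
    (hf : ContDiffOn ℝ ∞ f U) (l : List (Fin m)) (hl : l.Nodup) (hi : i ∈ l) :
    Set.EqOn (l.foldr (fun j g => (pderiv j)^[(I + one i) j] g) f)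
      (pderiv i (l.foldr (fun j g => (pderiv j)^[I j] g) f)) U := by
  induction l with
  | nil => simp at hi
  | cons a l ih =>
    rw [List.nodup_cons] at hl
    simp only [List.foldr_cons]
    by_cases hai : a = i
    · subst hai
      have h1 : l.foldr (fun j g => (pderiv j)^[(I + one a) j] g) f =
          l.foldr (fun j g => (pderiv j)^[I j] g) f := by
        refine List.foldr_ext _ _ f fun j hj g => ?_
        have : j ≠ a := fun h => hl.1 (h ▸ hj)
        simp [one, this]
      rw [h1]
      have h2 : (I + one a) a = I a + 1 := by simp [one]
      rw [h2, Function.iterate_succ_apply']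
      exact Set.eqOn_refl _ _
    · have hi' : i ∈ l := by
        rcases List.mem_cons.1 hi with h | h
        · exact absurd h.symm hai
        · exact h
      have h2 : (I + one i) a = I a := by simp [one, hai]
      rw [h2]
      exact (pderiv_iterate_congr hU a (ih hl.2 hi') _).trans
        (pderiv_iterate_comm hU i a (contDiffOn_foldr_pderiv hU I hf l) _)

lemma multiDeriv_add_one (hU : IsOpen U) (I : Fin m → ℕ) (i : Fin m) {f : (Fin m → ℝ) → ℝ}
    (hf : ContDiffOn ℝ ∞ f U) :
    Set.EqOn (multiDeriv (I + one i) f) (pderiv i (multiDeriv I f)) U :=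
  foldr_pderiv_add_one hU I i hf _ (List.nodup_finRange m) (List.mem_finRange i)

lemma multiDeriv_zero (f : (Fin m → ℝ) → ℝ) : multiDeriv 0 f = f := by
  simp [multiDeriv]

lemma uCoord_prolong {I : Fin m → ℕ} (hI : ∑ i, I i ≤ k) (φ : (Fin m → ℝ) → Fin n → ℝ)
    (x : Fin m → ℝ) (α : Fin n) :
    uCoord I α (prolong k φ x) = multiDeriv I (fun x' => φ x' α) x := by
  rw [uCoord_apply hI]; rfl

lemma uCoord_fderiv {ψ : (Fin m → ℝ) → JetCoord m n k} (hU : IsOpen U)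
    (hψ : ContDiffOn ℝ ∞ ψ U) {x : Fin m → ℝ} (hx : x ∈ U) (I : Fin m → ℕ) (α : Fin n)
    (i : Fin m) :
    uCoord I α (fderiv ℝ ψ x (Pi.single i 1)) = pderiv i (fun x => uCoord I α (ψ x)) x := by
  have hd : DifferentiableAt ℝ ψ x :=
    (hψ.contDiffAt (hU.mem_nhds hx)).differentiableAt (by simp)
  have := ((uCoord I α).hasFDerivAt.comp x hd.hasFDerivAt).fderiv
  rw [pderiv]
  exact (DFunLike.congr_fun this (Pi.single i 1)).symm

lemma fst_fderiv {ψ : (Fin m → ℝ) → JetCoord m n k} (hU : IsOpen U)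
    (hψ : ContDiffOn ℝ ∞ ψ U) (hψ1 : ∀ x ∈ U, (ψ x).1 = x) {x : Fin m → ℝ} (hx : x ∈ U)
    (v : Fin m → ℝ) : (fderiv ℝ ψ x v).1 = v := by
  have hd : DifferentiableAt ℝ ψ x :=
    (hψ.contDiffAt (hU.mem_nhds hx)).differentiableAt (by simp)
  have h1 := hd.hasFDerivAt.fst
  have h2 : HasFDerivAt (fun x => (ψ x).1) (ContinuousLinearMap.id ℝ (Fin m → ℝ)) x :=
    (hasFDerivAt_id x).congr_of_eventuallyEq
      ((show Set.EqOn (fun x => (ψ x).1) id U from hψ1).eventuallyEq_of_mem (hU.mem_nhds hx))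
  exact DFunLike.congr_fun (h1.unique h2) v

lemma contDiffOn_uCoord {ψ : (Fin m → ℝ) → JetCoord m n k} (hψ : ContDiffOn ℝ ∞ ψ U)
    (I : Fin m → ℕ) (α : Fin n) : ContDiffOn ℝ ∞ (fun x => uCoord I α (ψ x)) U :=
  (uCoord I α).contDiff.comp_contDiffOn hψ

/-- The tangent vectors of a holonomic section project to the total derivatives. -/
lemma IsHolonomicSection.jetProj_fderiv {ψ : (Fin m → ℝ) → JetCoord m n (k + 1)} (hU : IsOpen U)
    (hψ : ContDiffOn ℝ ∞ ψ U) (h : IsHolonomicSection U ψ) {x : Fin m → ℝ} (hx : x ∈ U)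
    (i : Fin m) :
    jetProj m n (k + 1) k (fderiv ℝ ψ x (Pi.single i 1)) = totalVec i (ψ x) := by
  have hu {I : Fin m → ℕ} (hI : ∑ i, I i ≤ k + 1) (α : Fin n) :
      Set.EqOn (fun x => uCoord I α (ψ x)) (multiDeriv I fun x => uCoord 0 α (ψ x)) U := by
    intro x hx
    dsimp only
    conv_lhs => rw [h x hx]
    exact uCoord_prolong hI _ x α
  refine jetCoord_ext ?_ fun I hI α => ?_
  · rw [jetProj_fst, totalVec_fst, fst_fderiv hU hψ (fun x hx => by rw [h x hx]; rfl) hx]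
  · rw [uCoord_jetProj hI, uCoord_totalVec hI, uCoord_fderiv hU hψ hx,
      pderiv_congr hU i (hu (hI.trans (Nat.le_succ k)) α) hx,
      ← multiDeriv_add_one hU I i (contDiffOn_uCoord hψ 0 α) hx]
    refine (hu ?_ α hx).symm
    rw [sum_add_one]; omega

/-- A section whose tangent vectors project to the total derivatives is holonomic: by induction
on `|I|`, its coordinate `u^α_I` is the derivative `∂_I` of its coordinate `u^α`. -/
lemma isHolonomicSection_of_jetProj_fderiv {ψ : (Fin m → ℝ) → JetCoord m n (k + 1)}
    (hU : IsOpen U) (hψ : ContDiffOn ℝ ∞ ψ U) (hψ1 : ∀ x ∈ U, (ψ x).1 = x)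
    (h : ∀ x ∈ U, ∀ i, jetProj m n (k + 1) k (fderiv ℝ ψ x (Pi.single i 1)) = totalVec i (ψ x)) :
    IsHolonomicSection U ψ := by
  have key : ∀ r : ℕ, ∀ I : Fin m → ℕ, ∑ i, I i = r → r ≤ k + 1 → ∀ α,
      Set.EqOn (multiDeriv I fun x => uCoord 0 α (ψ x)) (fun x => uCoord I α (ψ x)) U := by
    intro r
    induction r with
    | zero =>
      intro I hI _ α
      have : I = 0 := funext fun i => by simpa using (Finset.sum_eq_zero_iff.1 hI) i
      rw [this, multiDeriv_zero]
      exact Set.eqOn_refl _ _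
    | succ r ih =>
      intro I hI hr α x hx
      obtain ⟨J, i, rfl⟩ := exists_eq_add_one (I := I) (fun h => by simp [h] at hI)
      rw [sum_add_one] at hI
      have hJ : ∑ i, J i ≤ k := by omega
      rw [multiDeriv_add_one hU J i (contDiffOn_uCoord hψ 0 α) hx,
        pderiv_congr hU i (ih J (by omega) (by omega) α) hx, ← uCoord_fderiv hU hψ hx,
        ← uCoord_jetProj hJ, h x hx, uCoord_totalVec hJ]
  intro x hx
  refine jetCoord_ext (hψ1 x hx) fun I hI α => ?_
  rw [uCoord_prolong hI, key _ I rfl hI α hx]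

end Prolongation

/-! ### Decomposable multivectors with the same direction -/

section Frames

variable {m n k : ℕ}

/-- A linear form which vanishes on `v_1, …, v_m` vanishes on every horizontally normalized frame
`w` with `v_1 ∧ … ∧ v_m = c w_1 ∧ … ∧ w_m`: apply the form `η ∧ d^{m-1}x_i`. -/
lemma apply_eq_zero_of_ιMulti_eq {v w : Fin m → JetCoord m n k}
    (hw : ∀ j, (w j).1 = Pi.single j 1) {c : ℝ} (hc : c ≠ 0)
    (h : exteriorPower.ιMulti ℝ m v = c • exteriorPower.ιMulti ℝ m w)
    (η : JetCoord m n k →L[ℝ] ℝ) (hη : ∀ i, η (v i) = 0) (i : Fin m) : η (w i) = 0 := by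
  have h1 := congrArg (exteriorPower.alternatingMapLinearEquiv (wedgeDx η i).toAlternatingMap) h
  rw [map_smul, exteriorPower.alternatingMapLinearEquiv_apply_ιMulti,
    exteriorPower.alternatingMapLinearEquiv_apply_ιMulti] at h1
  have h2 : wedgeDx η i v = 0 := by
    change Matrix.det (fun j l => Function.update (fun j => xCoord j) i η l (v j)) = 0
    exact Matrix.det_eq_zero_of_column_eq_zero i fun j => by simp [hη]
  have h3 : wedgeDx η i v = c • wedgeDx η i w := h1
  rw [h2, wedgeDx_apply_frame η i hw, smul_eq_mul] at h3
  exact (mul_eq_zero.1 h3.symm).resolve_left hc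

lemma frame_eq_of_ιMulti_eq {v w : Fin m → JetCoord m n k}
    (hv : ∀ j, (v j).1 = Pi.single j 1) (hw : ∀ j, (w j).1 = Pi.single j 1) {c : ℝ} (hc : c ≠ 0)
    (h : exteriorPower.ιMulti ℝ m v = c • exteriorPower.ιMulti ℝ m w) : v = w := by
  funext i
  refine jetCoord_ext ((hv i).trans (hw i).symm) fun I _ α => ?_
  have h1 := apply_eq_zero_of_ιMulti_eq hw hc h
    (uCoord I α - ∑ j, uCoord I α (v j) • xCoord j) (fun i => ?_) i
  · simp [hw, Pi.single_apply] at h1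
    linarith
  · simp [hv, Pi.single_apply]

lemma ιMulti_ne_zero_of_frame {w : Fin m → JetCoord m n k}
    (hw : ∀ j, (w j).1 = Pi.single j 1) : exteriorPower.ιMulti ℝ m w ≠ 0 := by
  intro h
  have h1 := congrArg (exteriorPower.alternatingMapLinearEquiv
    (wedge fun i => (xCoord i : JetCoord m n k →L[ℝ] ℝ)).toAlternatingMap) h
  rw [map_zero, exteriorPower.alternatingMapLinearEquiv_apply_ιMulti] at h1
  exact one_ne_zero ((wedge_xCoord_apply_frame hw).symm.trans h1)

end Frames

/-! ### The holonomic multivector field whose integral sections are polynomial -/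

section TruncatedField

variable {m n k : ℕ}

/-- The linear part `u^α_I ↦ u^α_{I+1_i}` of the total derivative, truncated to `k`-jets: the
components with `|I| = k` are zero. -/
def shift (m n k : ℕ) (i : Fin m) : JetCoord m n k →L[ℝ] JetCoord m n k :=
  (0 : JetCoord m n k →L[ℝ] (Fin m → ℝ)).prod
    (ContinuousLinearMap.pi fun I : MultiIndex m k =>
      ContinuousLinearMap.pi fun α : Fin n => uCoord (I.1 + one i) α)

@[simp] lemma shift_fst (i : Fin m) (y : JetCoord m n k) : (shift m n k i y).1 = 0 := rfl

lemma uCoord_shift (I : Fin m → ℕ) (α : Fin n) (i : Fin m) (y : JetCoord m n k) :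
    uCoord I α (shift m n k i y) = uCoord (I + one i) α y := by
  by_cases hI : ∑ i, I i ≤ k
  · rw [uCoord_apply hI]; rfl
  · rw [uCoord_of_lt (not_le.1 hI), uCoord_of_lt]
    rw [sum_add_one]; omega

lemma shift_comm (i j : Fin m) (y : JetCoord m n k) :
    shift m n k i (shift m n k j y) = shift m n k j (shift m n k i y) := by
  refine jetCoord_ext rfl fun I _ α => ?_
  simp only [uCoord_shift, add_right_comm I]

/-- The truncated total derivative `∂/∂x^i + ∑_{|I|<k} u^α_{I+1_i} ∂/∂u^α_I` on `k`-jets. -/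
def truncVec (i : Fin m) (y : JetCoord m n k) : JetCoord m n k :=
  (Pi.single i 1, 0) + shift m n k i y

lemma truncVec_fst (i : Fin m) (y : JetCoord m n k) : (truncVec i y).1 = Pi.single i 1 := by
  simp [truncVec]

lemma uCoord_horizontal (I : Fin m → ℕ) (α : Fin n) (a : Fin m → ℝ) :
    uCoord I α ((a, 0) : JetCoord m n k) = 0 := by
  by_cases hI : ∑ i, I i ≤ k
  · rw [uCoord_apply hI]; rfl
  · exact uCoord_of_lt (not_le.1 hI) _ _

lemma jetProj_truncVec (i : Fin m) (y : JetCoord m n (k + 1)) :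
    jetProj m n (k + 1) k (truncVec i y) = totalVec i y := by
  refine jetCoord_ext (by rw [jetProj_fst, truncVec_fst, totalVec_fst]) fun I hI α => ?_
  rw [uCoord_jetProj hI, uCoord_totalVec hI, truncVec, map_add, uCoord_horizontal, uCoord_shift,
    zero_add]

lemma contDiff_truncVec (i : Fin m) :
    ContDiff ℝ ∞ (truncVec i : JetCoord m n k → JetCoord m n k) :=
  contDiff_const.add (shift m n k i).contDiff

/-- The operator `∑_i t_i N_i`, where `N_i` is the shift. -/
def shiftSum (m n k : ℕ) : (Fin m → ℝ) →L[ℝ] JetCoord m n k →L[ℝ] JetCoord m n k :=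
  ∑ i, (ContinuousLinearMap.proj i : (Fin m → ℝ) →L[ℝ] ℝ).smulRight (shift m n k i)

lemma shiftSum_apply (t : Fin m → ℝ) (y : JetCoord m n k) :
    shiftSum m n k t y = ∑ i, t i • shift m n k i y := by
  simp [shiftSum, sum_apply]

@[simp] lemma shiftSum_single (i : Fin m) : shiftSum m n k (Pi.single i 1) = shift m n k i := by
  refine ContinuousLinearMap.ext fun y => ?_
  rw [shiftSum_apply, Finset.sum_eq_single i (fun j _ h => by simp [h]) (by simp)]
  simp

@[simp] lemma shiftSum_fst (t : Fin m → ℝ) (y : JetCoord m n k) : (shiftSum m n k t y).1 = 0 := by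
  simp [shiftSum_apply, Prod.fst_sum]

lemma shift_shiftSum (i : Fin m) (t : Fin m → ℝ) (y : JetCoord m n k) :
    shift m n k i (shiftSum m n k t y) = shiftSum m n k t (shift m n k i y) := by
  simp only [shiftSum_apply, map_sum, map_smul, shift_comm i]

/-- Four shifts annihilate `3`-jets. -/
lemma shift_shiftSum_eq_zero (i : Fin m) (t : Fin m → ℝ) (y : JetCoord m n 3) :
    shift m n 3 i (shiftSum m n 3 t (shiftSum m n 3 t (shiftSum m n 3 t y))) = 0 := by
  refine jetCoord_ext rfl fun I _ α => ?_
  simp only [shiftSum_apply, map_sum, map_smul, uCoord_shift, map_zero]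
  refine Finset.sum_eq_zero fun a _ => smul_eq_zero_of_right _ (Finset.sum_eq_zero fun b _ =>
    smul_eq_zero_of_right _ (Finset.sum_eq_zero fun c _ => smul_eq_zero_of_right _ ?_))
  apply uCoord_of_lt
  simp only [sum_add_one]
  omega

/-- The section of `3`-jets of the cubic polynomial map with `3`-jet `y`, namely
`x ↦ exp(∑_i (x^i - x_0^i) N_i) y` with the base point moved to `x`. -/
def cubicSection (y : JetCoord m n 3) (x : Fin m → ℝ) : JetCoord m n 3 :=
  (x - y.1, 0) + (y + shiftSum m n 3 (x - y.1) y +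
    (1 / 2 : ℝ) • shiftSum m n 3 (x - y.1) (shiftSum m n 3 (x - y.1) y) +
    (1 / 6 : ℝ) • shiftSum m n 3 (x - y.1)
      (shiftSum m n 3 (x - y.1) (shiftSum m n 3 (x - y.1) y)))

lemma cubicSection_fst (y : JetCoord m n 3) (x : Fin m → ℝ) : (cubicSection y x).1 = x := by
  simp [cubicSection]

lemma cubicSection_self (y : JetCoord m n 3) : cubicSection y y.1 = y := by
  simp [cubicSection]

lemma contDiff_cubicSection (y : JetCoord m n 3) : ContDiff ℝ ∞ (cubicSection y) := by
  unfold cubicSection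
  have h : ContDiff ℝ ∞ fun x : Fin m → ℝ => shiftSum m n 3 (x - y.1) :=
    (shiftSum m n 3).contDiff.comp (contDiff_id.sub contDiff_const)
  have h1 := h.clm_apply (contDiff_const (c := y))
  have h2 := h.clm_apply h1
  have h3 := h.clm_apply h2
  exact ((contDiff_id.sub contDiff_const).prodMk contDiff_const).add
    (((contDiff_const.add h1).add (h2.const_smul (1 / 2 : ℝ))).add (h3.const_smul (1 / 6 : ℝ)))

lemma fderiv_cubicSection (y : JetCoord m n 3) (x : Fin m → ℝ) (i : Fin m) :
    fderiv ℝ (cubicSection y) x (Pi.single i 1) = truncVec i (cubicSection y x) := by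
  have hid : HasFDerivAt (fun x : Fin m → ℝ => x - y.1)
      (ContinuousLinearMap.id ℝ (Fin m → ℝ)) x := (hasFDerivAt_id x).sub_const y.1
  have h : HasFDerivAt (fun x : Fin m → ℝ => shiftSum m n 3 (x - y.1)) (shiftSum m n 3) x :=
    (shiftSum m n 3).hasFDerivAt.comp x hid
  have h1 := h.clm_apply (hasFDerivAt_const y x)
  have h2 := h.clm_apply h1
  have h3 := h.clm_apply h2
  have h0 := hid.prodMk (hasFDerivAt_const (0 : MultiIndex m 3 → Fin n → ℝ) x)
  have hs := h0.add ((((hasFDerivAt_const y x).add h1).add (h2.const_smul (1 / 2 : ℝ))).add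
    (h3.const_smul (1 / 6 : ℝ)))
  refine (DFunLike.congr_fun (show fderiv ℝ (cubicSection y) x = _ from hs.fderiv)
    (Pi.single i 1)).trans ?_
  rw [truncVec, cubicSection]
  simp only [_root_.add_apply, _root_.smul_apply, ContinuousLinearMap.comp_apply,
    ContinuousLinearMap.flip_apply, ContinuousLinearMap.prod_apply, shiftSum_single, map_add,
    map_smul, _root_.zero_apply, map_zero, shift_shiftSum]
  have hh : shift m n 3 i ((x - y.1, 0) : JetCoord m n 3) = 0 := by
    refine jetCoord_ext rfl fun I _ α => ?_
    rw [uCoord_shift, uCoord_horizontal, map_zero]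
  have hz := shift_shiftSum_eq_zero i (x - y.1) y
  simp only [shift_shiftSum] at hz
  rw [hh, hz]
  simp only [ContinuousLinearMap.id_apply]
  module

/-- The multivector field `D_1 ∧ … ∧ D_m` with truncated total derivatives. -/
def truncField (m n k : ℕ) (y : JetCoord m n k) : ⋀[ℝ]^m (JetCoord m n k) :=
  exteriorPower.ιMulti ℝ m fun i => truncVec i y

lemma isHolonomicOn_truncField {O : Set (JetCoord m n 3)} (hO : IsOpen O) :
    IsHolonomicOn (truncField m n 3) O := by
  refine ⟨fun y hy => ⟨O, hO, hy, truncVec, fun i => (contDiff_truncVec i).contDiffOn,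
    fun z _ => rfl⟩, fun y _ => ιMulti_ne_zero_of_frame fun j => truncVec_fst j y,
    fun y hy => ⟨cubicSection y ⁻¹' O, cubicSection y, ⟨?_, ?_, ?_, ?_, ?_⟩, ?_, ?_⟩, ?_⟩
  · exact hO.preimage (contDiff_cubicSection y).continuous
  · exact (contDiff_cubicSection y).contDiffOn
  · exact fun x _ => cubicSection_fst y x
  · exact fun x hx => hx
  · refine fun x _ => ⟨1, one_ne_zero, ?_⟩
    simp only [truncField, one_smul, fderiv_cubicSection]
  · rwa [Set.mem_preimage, cubicSection_self]
  · exact cubicSection_self y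
  · rintro U ψ ⟨hU, hψ, hψ1, -, hX⟩
    refine isHolonomicSection_of_jetProj_fderiv hU hψ hψ1 fun x hx i => ?_
    obtain ⟨c, hc, h⟩ := hX x hx
    have := frame_eq_of_ιMulti_eq (fun j => truncVec_fst j (ψ x))
      (fun j => fst_fderiv hU hψ hψ1 hx (Pi.single j 1)) hc h
    rw [← congrFun this i, jetProj_truncVec]

end TruncatedField

/-! ### Solutions of the Euler–Lagrange equations -/

section Solutions

variable {m n : ℕ}

/-- Through every point of `N` there passes a section with values in `N` which is tangent to `X`
and whose tangent vectors project to the total derivatives. -/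
lemma IsHolonomicOn.exists_section {k : ℕ}
    {X : JetCoord m n (k + 1) → ⋀[ℝ]^m (JetCoord m n (k + 1))}
    {N : Set (JetCoord m n (k + 1))} (h : IsHolonomicOn X N) {y : JetCoord m n (k + 1)}
    (hy : y ∈ N) :
    ∃ (U : Set (Fin m → ℝ)) (ψ : (Fin m → ℝ) → JetCoord m n (k + 1)), IsOpen U ∧
      ContDiffOn ℝ ∞ ψ U ∧ (∀ x ∈ U, ψ x ∈ N) ∧ y.1 ∈ U ∧ ψ y.1 = y ∧
      ∀ x ∈ U, (∃ c : ℝ, c ≠ 0 ∧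
          X (ψ x) = c • exteriorPower.ιMulti ℝ m (fun i => fderiv ℝ ψ x (Pi.single i 1))) ∧
        ∀ i, jetProj m n (k + 1) k (fderiv ℝ ψ x (Pi.single i 1)) = totalVec i (ψ x) := by
  obtain ⟨-, -, h3, h4⟩ := h
  obtain ⟨U, ψ, hψ, hyU, hψy⟩ := h3 y hy
  exact ⟨U, ψ, hψ.1, hψ.2.1, hψ.2.2.2.1, hyU, hψy, fun x hx => ⟨hψ.2.2.2.2 x hx,
    fun i => (h4 U ψ hψ).jetProj_fderiv hψ.1 hψ.2.1 hx i⟩⟩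

variable {Ω : Set ((Fin m → ℝ) × (Fin n → ℝ))} {L : JetCoord m n 2 → ℝ}
  {g : Fin n → Fin m → JetCoord m n 2 → ℝ}

lemma euler3_eq_zero_of_fieldEq (hΩ : IsOpen Ω) (hL : ContDiffOn ℝ ∞ L (jetDomain Ω 2))
    (hg : ∀ α i, ContDiffOn ℝ ∞ (g α i) (jetDomain Ω 2))
    (hLg : ∀ α i, ∀ y ∈ jetDomain Ω 3, legendre1 L α i y = g α i (jetProj m n 3 2 y))
    {X : JetCoord m n 3 → ⋀[ℝ]^m (JetCoord m n 3)} {N : Set (JetCoord m n 3)}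
    (hX : IsHolonomicOn X N) {y : JetCoord m n 3} (hyN : y ∈ N) (hy : y ∈ jetDomain Ω 3)
    (hf : FieldEq L X y) (α : Fin n) : euler3 L g α y = 0 := by
  obtain ⟨U, ψ, -, -, -, hyU, hψy, h⟩ := hX.exists_section hyN
  obtain ⟨⟨c, hc, hXc⟩, hw⟩ := h y.1 hyU
  rw [hψy] at hXc hw
  exact (fieldEq_iff_euler3 hΩ hL hg hLg hy hw hc hXc).1 hf α

lemma fieldEq_truncField (hΩ : IsOpen Ω) (hL : ContDiffOn ℝ ∞ L (jetDomain Ω 2))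
    (hg : ∀ α i, ContDiffOn ℝ ∞ (g α i) (jetDomain Ω 2))
    (hLg : ∀ α i, ∀ y ∈ jetDomain Ω 3, legendre1 L α i y = g α i (jetProj m n 3 2 y))
    {y : JetCoord m n 3} (hy : y ∈ jetDomain Ω 3) (h : ∀ α, euler3 L g α y = 0) :
    FieldEq L (truncField m n 3) y :=
  (fieldEq_iff_euler3 hΩ hL hg hLg hy (fun i => jetProj_truncVec i y) one_ne_zero
    (one_smul ℝ _).symm).2 h

lemma fderiv_comp_jetProj {k l : ℕ} {f : JetCoord m n l → ℝ} {y : JetCoord m n k}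
    (hf : DifferentiableAt ℝ f (jetProj m n k l y)) (v : JetCoord m n k) :
    fderiv ℝ (fun z => f (jetProj m n k l z)) y v =
      fderiv ℝ f (jetProj m n k l y) (jetProj m n k l v) :=
  DFunLike.congr_fun (hf.hasFDerivAt.comp y (jetProj m n k l).hasFDerivAt).fderiv v

/-- If a function of `k`-jets vanishes along a holonomic section, so do its total derivatives. -/
lemma totalDeriv_eq_zero_of_section {k : ℕ} {f : JetCoord m n k → ℝ} {U : Set (Fin m → ℝ)}
    (hU : IsOpen U) {ψ : (Fin m → ℝ) → JetCoord m n (k + 1)} (hψ : ContDiffOn ℝ ∞ ψ U)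
    (h0 : ∀ x ∈ U, f (jetProj m n (k + 1) k (ψ x)) = 0) {x : Fin m → ℝ} (hx : x ∈ U)
    (hf : DifferentiableAt ℝ f (jetProj m n (k + 1) k (ψ x))) {i : Fin m}
    (hw : jetProj m n (k + 1) k (fderiv ℝ ψ x (Pi.single i 1)) = totalVec i (ψ x)) :
    totalDeriv i f (ψ x) = 0 := by
  have hd : DifferentiableAt ℝ ψ x :=
    (hψ.contDiffAt (hU.mem_nhds hx)).differentiableAt (by simp)
  have h1 : HasFDerivAt (fun x => f (jetProj m n (k + 1) k (ψ x)))
      ((fderiv ℝ f (jetProj m n (k + 1) k (ψ x))).comp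
        ((jetProj m n (k + 1) k).comp (fderiv ℝ ψ x))) x :=
    hf.hasFDerivAt.comp x ((jetProj m n (k + 1) k).hasFDerivAt.comp x hd.hasFDerivAt)
  have h2 : HasFDerivAt (fun x => f (jetProj m n (k + 1) k (ψ x)))
      (0 : (Fin m → ℝ) →L[ℝ] ℝ) x :=
    (hasFDerivAt_const (0 : ℝ) x).congr_of_eventuallyEq
      ((show Set.EqOn _ (fun _ => (0 : ℝ)) U from h0).eventuallyEq_of_mem (hU.mem_nhds hx))
  have h3 := DFunLike.congr_fun (h1.unique h2) (Pi.single i 1)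
  simp only [ContinuousLinearMap.comp_apply, hw] at h3
  exact h3

end Solutions

/-! ### Charts of the jet bundles -/

section Charts

variable {m n : ℕ} {M E : Type*} [TopologicalSpace M] [ChartedSpace (Fin m → ℝ) M]
  [TopologicalSpace E] [ChartedSpace ((Fin m → ℝ) × (Fin n → ℝ)) E] {π : E → M}

lemma AdaptedChart.jetCoord_mem (e : AdaptedChart m n π) {k : ℕ} {p : JetBundle m n π k}
    (hp : p ∈ e.jetSource k) : e.jetCoord p ∈ jetDomain e.total.target k := by
  obtain ⟨x, q⟩ := p
  have hp' : q.out.toFun x ∈ e.total.source := hp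
  obtain ⟨U, -, hxU, -, hsec⟩ := q.out.isSection
  have hπ : π (q.out.toFun x) = x := hsec _ hxU
  have hb : x ∈ e.base.source := hπ ▸ e.mem_base _ hp'
  have h : (e.base x, fun α => uCoord 0 α (prolong (n := n) k (e.expr q.out) (e.base x))) =
      e.total (q.out.toFun x) := by
    refine Prod.ext ?_ (funext fun α => ?_)
    · rw [e.fibred _ hp', hπ]
    · dsimp only
      rw [uCoord_prolong (by simp), multiDeriv_zero]
      simp [AdaptedChart.expr, e.base.left_inv hb]
  have h2 := e.total.map_source hp'
  rwa [← h] at h2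

variable {e : AdaptedChart m n π} {L : JetBundle m n π 2 → ℝ}
  {g : Fin n → Fin m → JetCoord m n 2 → ℝ}

lemma hasSolutionAt_of_euler3_eq_zero
    (hL : ContDiffOn ℝ ∞ (e.localRep L) (jetDomain e.total.target 2))
    (hg : ∀ α i, ContDiffOn ℝ ∞ (g α i) (jetDomain e.total.target 2))
    (hLg : ∀ α i, ∀ y ∈ jetDomain e.total.target 3,
      legendre1 (e.localRep L) α i y = g α i (jetProj m n 3 2 y))
    {p : JetBundle m n π 3} (hp : p ∈ e.jetSource 3)
    (h : ∀ α, euler3 (e.localRep L) g α (e.jetCoord p) = 0)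
    {C : ⋀[ℝ]^m (JetCoord m n 3) → Prop} (hC : C (truncField m n 3 (e.jetCoord p))) :
    HasSolutionAt L e p C :=
  ⟨jetDomain e.total.target 3, isOpen_jetDomain e.total.open_target, e.jetCoord_mem hp,
    subset_rfl, truncField m n 3,
    isHolonomicOn_truncField (isOpen_jetDomain e.total.open_target),
    fieldEq_truncField e.total.open_target hL hg hLg (e.jetCoord_mem hp) h, hC⟩

lemma euler3_eq_zero_of_hasSolutionAt
    (hL : ContDiffOn ℝ ∞ (e.localRep L) (jetDomain e.total.target 2))
    (hg : ∀ α i, ContDiffOn ℝ ∞ (g α i) (jetDomain e.total.target 2))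
    (hLg : ∀ α i, ∀ y ∈ jetDomain e.total.target 3,
      legendre1 (e.localRep L) α i y = g α i (jetProj m n 3 2 y))
    {p : JetBundle m n π 3} (hp : p ∈ e.jetSource 3)
    {C : ⋀[ℝ]^m (JetCoord m n 3) → Prop} (h : HasSolutionAt L e p C) (α : Fin n) :
    euler3 (e.localRep L) g α (e.jetCoord p) = 0 := by
  obtain ⟨O, -, hpO, -, X, hX, hf, -⟩ := h
  exact euler3_eq_zero_of_fieldEq e.total.open_target hL hg hLg hX hpO (e.jetCoord_mem hp) hf α

lemma euler3_eq_zero_of_hasSolutionOn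
    (hL : ContDiffOn ℝ ∞ (e.localRep L) (jetDomain e.total.target 2))
    (hg : ∀ α i, ContDiffOn ℝ ∞ (g α i) (jetDomain e.total.target 2))
    (hLg : ∀ α i, ∀ y ∈ jetDomain e.total.target 3,
      legendre1 (e.localRep L) α i y = g α i (jetProj m n 3 2 y))
    {N : Set (JetBundle m n π 3)} (hN : N ⊆ e.jetSource 3)
    {X : JetCoord m n 3 → ⋀[ℝ]^m (JetCoord m n 3)} (hX : IsHolonomicOn X (e.jetCoord '' N))
    (hf : ∀ p ∈ N, FieldEq (e.localRep L) X (e.jetCoord p))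
    {y : JetCoord m n 3} (hy : y ∈ e.jetCoord '' N) (α : Fin n) :
    euler3 (e.localRep L) g α y = 0 := by
  obtain ⟨p, hp, rfl⟩ := hy
  exact euler3_eq_zero_of_fieldEq e.total.open_target hL hg hLg hX (Set.mem_image_of_mem _ hp)
    (e.jetCoord_mem (hN hp)) (hf p hp) α

end Charts

end SecondOrderFieldTheory

end

open SecondOrderFieldTheory in
theorem theorem1 {m n : ℕ} {M E : Type*}
    [TopologicalSpace M] [ChartedSpace (Fin m → ℝ) M] [IsManifold 𝓘(ℝ, Fin m → ℝ) ∞ M]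
    [TopologicalSpace E] [ChartedSpace ((Fin m → ℝ) × (Fin n → ℝ)) E]
    [IsManifold 𝓘(ℝ, (Fin m → ℝ) × (Fin n → ℝ)) ∞ E]
    (π : E → M) (hπ : Function.Surjective π)
    (hπ' : Manifold.IsSubmersion 𝓘(ℝ, (Fin m → ℝ) × (Fin n → ℝ)) 𝓘(ℝ, Fin m → ℝ) ∞ π)
    (vol : ∀ x : M, TangentSpace 𝓘(ℝ, Fin m → ℝ) x [⋀^Fin m]→ₗ[ℝ] ℝ) (hvol : IsVolumeForm vol)
    (L : JetBundle m n π 2 → ℝ) (hL : SmoothOnJets L)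
    (e : AdaptedChart m n π) (he : e.IsNatural vol) :
    -- the two expressions of the functions `L^0_α`
    (∀ α, ∀ z ∈ e.jetTarget 4, legendre0 (e.localRep L) α z =
      partialU 0 α (e.localRep L) (jetProj m n 4 2 z)
      - ∑ i, totalDeriv i (partialU (one i) α (e.localRep L)) (jetProj m n 4 3 z)
      + ∑ i, ∑ j ∈ Finset.Ici i,
          totalDeriv i (totalDeriv j (partialU (one i + one j) α (e.localRep L))) z) ∧
    -- the case `s = 2`
    (Projects vol L 2 →
      ∃ G : Fin n → JetCoord m n 3 → ℝ,
        (∀ α, ContDiffOn ℝ ∞ (G α) (e.jetTarget 3)) ∧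
        (∀ α, ∀ z ∈ e.jetTarget 4, legendre0 (e.localRep L) α z = G α (jetProj m n 4 3 z)) ∧
        (∀ p ∈ e.jetSource 3,
          HasSolutionAt L e p (fun _ => True) ↔ ∀ α, G α (e.jetCoord p) = 0) ∧
        (∀ N ⊆ e.jetSource 3, HasSolutionOn L e N →
          N ⊆ {p | ∀ α, G α (e.jetCoord p) = 0})) ∧
    -- the case `s = 1`
    (Projects vol L 1 →
      ∃ G : Fin n → JetCoord m n 2 → ℝ,
        (∀ α, ContDiffOn ℝ ∞ (G α) (e.jetTarget 2)) ∧
        (∀ α, ∀ z ∈ e.jetTarget 4, legendre0 (e.localRep L) α z = G α (jetProj m n 4 2 z)) ∧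
        (∀ p ∈ e.jetSource 3,
          HasSolutionAt L e p (fun _ => True) ↔
            ∀ α, G α (jetProj m n 3 2 (e.jetCoord p)) = 0) ∧
        (∀ p ∈ e.jetSource 3,
          HasSolutionAt L e p
              (TangencyCond (fun α y => G α (jetProj m n 3 2 y)) (e.jetCoord p)) ↔
            (∀ α, G α (jetProj m n 3 2 (e.jetCoord p)) = 0) ∧
              ∀ i α, totalDeriv i (G α) (e.jetCoord p) = 0) ∧
        (∀ N ⊆ e.jetSource 3, HasSolutionOn L e N →
          N ⊆ {p | (∀ α, G α (jetProj m n 3 2 (e.jetCoord p)) = 0) ∧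
            ∀ i α, totalDeriv i (G α) (e.jetCoord p) = 0})) := by
  have hΩ := e.total.open_target
  have hLe : ContDiffOn ℝ ∞ (e.localRep L) (jetDomain e.total.target 2) := hL e
  refine ⟨fun α z hz => legendre0_eq hΩ hLe α hz, fun hs => ?_, fun hs => ?_⟩
  · obtain ⟨θ, hθ, hΘ⟩ := hs e he
    obtain ⟨g, hg, hLg⟩ := exists_legendre1_eq_comp (by norm_num) hθ hΘ
    refine ⟨euler3 (e.localRep L) g, contDiffOn_euler3 hΩ hLe hg,
      fun α z hz => legendre0_eq_euler3 hΩ hg hLg α hz, fun p hp => ⟨fun h =>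
        euler3_eq_zero_of_hasSolutionAt hLe hg hLg hp h, fun h =>
        hasSolutionAt_of_euler3_eq_zero hLe hg hLg hp h trivial⟩, ?_⟩
    rintro N hN ⟨X, hX, hf⟩ p hp α
    exact euler3_eq_zero_of_hasSolutionOn hLe hg hLg hN hX hf (Set.mem_image_of_mem _ hp) α
  · obtain ⟨θ, hθ, hΘ⟩ := hs e he
    obtain ⟨g₁, hg₁, hLg₁⟩ := exists_legendre1_eq_comp (by norm_num) hθ hΘ
    -- `g` regards the functions `g₁` as functions of `2`-jets
    let g : Fin n → Fin m → JetCoord m n 2 → ℝ := fun α i y => g₁ α i (jetProj m n 2 1 y)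
    have hg : ∀ α i, ContDiffOn ℝ ∞ (g α i) (jetDomain e.total.target 2) :=
      fun α i => contDiffOn_comp_jetProj (hg₁ α i)
    have hLg : ∀ α i, ∀ y ∈ jetDomain e.total.target 3,
        legendre1 (e.localRep L) α i y = g α i (jetProj m n 3 2 y) := fun α i y hy => by
      rw [hLg₁ α i y hy]
      simp only [g]
      rw [jetProj_jetProj (by norm_num)]
    have hG := contDiffOn_euler2 hΩ hLe hg₁
    have hE : ∀ α, ∀ y ∈ jetDomain e.total.target 3, euler3 (e.localRep L) g α y =
        euler2 (e.localRep L) g₁ α (jetProj m n 3 2 y) :=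
      fun α y hy => euler3_comp_jetProj hΩ hg₁ α hy
    have hGd : ∀ α, ∀ y ∈ jetDomain e.total.target 3,
        DifferentiableAt ℝ (euler2 (e.localRep L) g₁ α) (jetProj m n 3 2 y) := fun α y hy =>
      differentiableAt_of_contDiffOn hΩ (hG α) ((jetProj_mem_jetDomain_iff y).2 hy)
    have hmem {p : JetBundle m n π 3} (hp : p ∈ e.jetSource 3) := e.jetCoord_mem hp
    refine ⟨euler2 (e.localRep L) g₁, hG, fun α z hz => ?_, fun p hp => ⟨fun h α => ?_, fun h => ?_⟩,
      fun p hp => ⟨fun h => ⟨fun α => ?_, fun i α => ?_⟩, fun h => ?_⟩, ?_⟩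
    · rw [legendre0_eq_euler3 hΩ hg hLg α hz, hE α _ ((jetProj_mem_jetDomain_iff z).2 hz),
        jetProj_jetProj (by norm_num)]
    · rw [← hE α _ (hmem hp)]
      exact euler3_eq_zero_of_hasSolutionAt hLe hg hLg hp h α
    · exact hasSolutionAt_of_euler3_eq_zero hLe hg hLg hp
        (fun α => (hE α _ (hmem hp)).trans (h α)) trivial
    · rw [← hE α _ (hmem hp)]
      exact euler3_eq_zero_of_hasSolutionAt hLe hg hLg hp h α
    · -- the tangency condition passes from `v` to the tangent frame of an integral section
      obtain ⟨O, -, hpO, -, X, hX, -, v, hv, hvG⟩ := h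
      obtain ⟨U, ψ, hU, hψ, -, hyU, hψy, hU'⟩ := hX.exists_section hpO
      obtain ⟨⟨c, hc, hXc⟩, hw⟩ := hU' _ hyU
      rw [hψy, hv] at hXc
      rw [hψy] at hw
      have h0 := apply_eq_zero_of_ιMulti_eq (fun j => by
        rw [← jetProj_fst (l := 2), hw, totalVec_fst]) hc hXc
        (fderiv ℝ (fun y => euler2 (e.localRep L) g₁ α (jetProj m n 3 2 y)) (e.jetCoord p))
        (fun i => hvG i α) i
      rwa [fderiv_comp_jetProj (hGd α _ (hmem hp)), hw] at h0
    · refine hasSolutionAt_of_euler3_eq_zero hLe hg hLg hp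
        (fun α => (hE α _ (hmem hp)).trans (h.1 α))
        ⟨fun i => truncVec i (e.jetCoord p), rfl, fun i α => ?_⟩
      rw [fderiv_comp_jetProj (hGd α _ (hmem hp)), jetProj_truncVec]
      exact h.2 i α
    · rintro N hN ⟨X, hX, hf⟩ p hp
      have hzero : ∀ y ∈ e.jetCoord '' N, ∀ α,
          euler2 (e.localRep L) g₁ α (jetProj m n 3 2 y) = 0 := by
        intro y hy α
        rw [← euler3_eq_zero_of_hasSolutionOn hLe hg hLg hN hX hf hy α, hE]
        obtain ⟨q, hq, rfl⟩ := hy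
        exact hmem (hN hq)
      have hpN := Set.mem_image_of_mem e.jetCoord hp
      refine ⟨hzero _ hpN, fun i α => ?_⟩
      obtain ⟨U, ψ, hU, hψ, hψN, hyU, hψy, hU'⟩ := hX.exists_section hpN
      rw [← hψy]
      refine totalDeriv_eq_zero_of_section hU hψ (fun x hx => hzero _ (hψN x hx) α) hyU ?_
        ((hU' _ hyU).2 i)
      rw [hψy]
      exact hGd α _ (hmem (hN hp))
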